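/- **Generalized trigonometric functions.** For an integer $a\ge 1$ let $F_a(x)=\int_0^x (1-s^{2a})^{-1/2}\,ds$ for $x\in[0,1]$ and $\pi_a=2F_a(1)$. Let $\sin_a:\mathbb R\to\mathbb R$ be the inverse of $F_a$ on $[0,\pi_a/2]$, extended by $\sin_a(y)=\sin_a(\pi_a-y)$ to $[0,\pi_a]$, then as an odd function to $[-\pi_a,\pi_a]$ and then $2\pi_a$-periodically; put $\cos_a=\sin_a'$ and $\cot_a=\cos_a/\sin_a$. For $a=0$ put $\sin_0=\sin$, $\cos_0=\cos$, $\pi_0=\pi$. For $a\geq 1$ let $\rho_a(x)=|x|^{a-1}x$. **Grushin space.** Let $n\ge1$, $\alpha=(\alpha_1,\dots,\alpha_n)\in(\mathbb N\cup\{0\})^n$ and $J=\{j\in\{1,\dots,n\}:\alpha_j\ne0\}$. On $\mathbb R^{n+1}$ let $\xi_j(x)=\prod_{i<j}x_i^{\alpha_i}$ and $X_j=\xi_j\partial_{x_j}$ for $1\le j\le n+1$ (empty products are $1$); these fields define the Grushin space $\mathbb G^{n+1}_\alpha$, with Hamiltonian $H(x,p)=\frac12\sum_{j=1}^{n+1}\xi_j(x)^2p_j^2$.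 The geodesic $\gamma(\cdot\,;p^0)$ from $x^0$ with initial covector $p^0$ is the $x$-component of the solution $(x,p)$ of $x'=\partial H/\partial p$, $p'=-\partial H/\partial x$ with $(x,p)(0)=(x^0,p^0)$, and $\exp_{x^0}(p^0)=\gamma(1;p^0)$. The point $x^0$ is Riemannian if $X_1(x^0),\dots,X_{n+1}(x^0)$ span $\mathbb R^{n+1}$, that is, if $x^0_j\ne0$ for all $j\in J$. **Spherical coordinates.** Let $x^0$ be a Riemannian point. Let $\mathcal R^0_\alpha$ be the set of $\phi=(\phi_1,\dots,\phi_n)$ with $\phi_j\in[0,\pi_{\alpha_j}]$ for $j\le n-1$, $\phi_n\in[0,2\pi_{\alpha_n})$ and $\sin_{\alpha_j}(\phi_j)\neq0$ for all $j\le n$. For $1\le j\le n$ put $\delta_j=\rho_{\alpha_j}\!\big(\sin_{\alpha_j}(\phi_j)/x^0_j\big)$ if $j\in J$ and $\delta_j=\sin(\phi_j)$ if $j\notin J$, and define the covector $p^0(\phi)$ by $$p^0_j=\cos_{\alpha_j}(\phi_j)\prod_{i<j}\delta_i\quad(1\le j\le n),\qquad p^0_{n+1}=\prod_{i\le n}\delta_i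 .$$ Let $x(s)=\gamma(s;p^0(\phi))$ and write $I_j(t)=\int_0^t\xi_j(x(s))^2\,ds$. For $j\in J$ put $\omega_j=\frac{\sin_{\alpha_j}(\phi_j)}{x^0_j}\prod_{i<j}\delta_i$ and $Q_j=\omega_jI_j(t)+\phi_j$. Set $$S_j=\begin{cases}I_j(t), & j\notin J,\\ \cos_{\alpha_j}(Q_j)\big(\cot_{\alpha_j}(\phi_j)\,\omega_jI_j(t)+1\big)-\cot_{\alpha_j}(\phi_j)\sin_{\alpha_j}(Q_j), & j\in J,\end{cases}$$ $$g(\phi)=(-1)^{|J|}\Big(\prod_{\substack{1\le j\le n\\ j\notin J}}\ \prod_{i=1}^{j-1}\delta_i\Big)\prod_{j\in J}\left|\frac{x^0_j}{\sin_{\alpha_j}(\phi_j)}\right|^{\alpha_j+1}.$$ **Lemma (Determinant Formula).** Let $n\ge 1$, $\alpha\in(\mathbb N\cup\{0\})^n$, let $x^0$ be a Riemannian point of $\mathbb G^{n+1}_\alpha$ and let $\phi\in\mathcal R^0_\alpha$. Then Hamilton's equations have exactly one solution on $\mathbb R$ starting at $(x^0,p^0(\phi))$; $g(\phi)\ne0$;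 and for every $t\in\mathbb R$ the map $(t,\phi)\mapsto\exp_{x^0}(t\,p^0(\phi))$ is differentiable at $(t,\phi)$, and its Jacobian determinant $D(t,\phi)$ (rows $x_1,\dots,x_{n+1}$, columns $t,\phi_1,\dots,\phi_n$) is $$D(t,\phi)=g(\phi)\prod_{j=1}^nS_j .$$ -/

import Mathlib

namespace Grushin

/-! Generalized trigonometric functions: `sin_α = sin_{2α,2}` for an integer `α ≥ 1`. -/

/-- `F_{2α,2}(x) = ∫₀ˣ (1 - s^{2α})^{-1/2} ds`, used for `x ∈ [0,1]`. -/
noncomputable def genF (a : ℕ) (x : ℝ) : ℝ :=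
  ∫ s in (0 : ℝ)..x, 1 / Real.sqrt (1 - s ^ (2 * a))

/-- The half period `π_α = 2 F_{2α,2}(1)`. -/
noncomputable def genPi (a : ℕ) : ℝ := 2 * genF a 1

/-- The inverse `[0, π_α / 2] → [0, 1]` of `F_{2α,2} : [0, 1] → [0, π_α / 2]`. -/
noncomputable def genSinQuarter (a : ℕ) (y : ℝ) : ℝ :=
  Function.invFunOn (genF a) (Set.Icc 0 1) y

/-- `sin_α` on the real line: the inverse of `F_{2α,2}` on `[0, π_α / 2]`, extended by the
reflection `y ↦ π_α - y` to `[0, π_α]`, then as an odd function to `[-π_α, π_α]`, then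
`2 π_α`-periodically; `r ∈ [-π_α, π_α]` is the representative of `y` modulo `2 π_α`. -/
noncomputable def genSin (a : ℕ) (y : ℝ) : ℝ :=
  let r := y - 2 * genPi a * (round (y / (2 * genPi a)) : ℝ)
  Real.sign r * genSinQuarter a (min |r| (genPi a - |r|))

/-- `cos_α` is the derivative of `sin_α`. -/
noncomputable def genCos (a : ℕ) : ℝ → ℝ := deriv (genSin a)

/-- `cot_α = cos_α / sin_α`. -/
noncomputable def genCot (a : ℕ) (y : ℝ) : ℝ := genCos a y / genSin a y

/-- `ρ_θ(x) = |x|^{θ-1} x`, used for `θ ≥ 1`. -/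
noncomputable def rho (a : ℕ) (x : ℝ) : ℝ := |x| ^ (a - 1) * x

/-! For an index with `α_j = 0` the exponent is replaced by `1`, so that the trigonometric
functions of that index are the usual ones. -/

/-- `sin_{α̃}`: the usual sine when `α = 0`, and `sin_α` otherwise. -/
noncomputable def sinT (a : ℕ) (y : ℝ) : ℝ := if a = 0 then Real.sin y else genSin a y

/-- `cos_{α̃}`: the usual cosine when `α = 0`, and `cos_α` otherwise. -/
noncomputable def cosT (a : ℕ) (y : ℝ) : ℝ := if a = 0 then Real.cos y else genCos a y

/-- `π_{α̃}`: the usual `π` when `α = 0`, and `π_α` otherwise. -/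
noncomputable def piT (a : ℕ) : ℝ := if a = 0 then Real.pi else genPi a

variable {n : ℕ}

/-! The Grushin structure on `ℝ^{n+1}`. The exponents `α_1, …, α_n` are indexed by `Fin n`, the
coordinates `x_1, …, x_{n+1}` by `Fin (n + 1)`; `x_i` with `i ≤ n` is `x i.castSucc`. -/

/-- `ξ_j(x) = ∏_{i < j} x_i^{α_i}`. -/
noncomputable def xi (α : Fin n → ℕ) (j : Fin (n + 1)) (x : Fin (n + 1) → ℝ) : ℝ :=
  ∏ i : Fin n with i.castSucc < j, x i.castSucc ^ α i

/-- The vector field `X_j = ξ_j ∂_{x_j}`. -/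
noncomputable def vectorField (α : Fin n → ℕ) (j : Fin (n + 1)) (x : Fin (n + 1) → ℝ) :
    Fin (n + 1) → ℝ :=
  Pi.single j (xi α j x)

/-- `x` is a Riemannian point: the vector fields span the tangent space at `x`. -/
def IsRiemannianPoint (α : Fin n → ℕ) (x : Fin (n + 1) → ℝ) : Prop :=
  Submodule.span ℝ (Set.range fun j => vectorField α j x) = ⊤

/-- The sub-Riemannian Hamiltonian `H(x, p) = ½ ∑_j ⟨p, X_j(x)⟩²`. -/
noncomputable def hamiltonian (α : Fin n → ℕ) (x p : Fin (n + 1) → ℝ) : ℝ :=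
  (1 / 2) * ∑ j, (p ⬝ᵥ vectorField α j x) ^ 2

/-- The Hamiltonian vector field `(∂H/∂p, -∂H/∂x)` on the cotangent bundle `ℝ^{n+1} × ℝ^{n+1}`. -/
noncomputable def hamiltonianVF (α : Fin n → ℕ)
    (z : (Fin (n + 1) → ℝ) × (Fin (n + 1) → ℝ)) : (Fin (n + 1) → ℝ) × (Fin (n + 1) → ℝ) :=
  (fun j => fderiv ℝ (fun q => hamiltonian α z.1 q) z.2 (Pi.single j 1),
   fun j => -fderiv ℝ (fun y => hamiltonian α y z.2) z.1 (Pi.single j 1))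

/-- `z = (x, p)` solves Hamilton's equations with `z(0) = (x⁰, p⁰)`. -/
def IsExtremalFrom (α : Fin n → ℕ) (x₀ p₀ : Fin (n + 1) → ℝ)
    (z : ℝ → (Fin (n + 1) → ℝ) × (Fin (n + 1) → ℝ)) : Prop :=
  (∀ t, HasDerivAt z (hamiltonianVF α (z t)) t) ∧ z 0 = (x₀, p₀)

open Classical in
/-- The geodesic `t ↦ γ(t; p⁰)` from `x⁰` with initial covector `p⁰`: the projection to `ℝ^{n+1}`
of the solution of Hamilton's equations (constant if there were no solution). -/
noncomputable def geodesic (α : Fin n → ℕ) (x₀ p₀ : Fin (n + 1) → ℝ) (t : ℝ) : Fin (n + 1) → ℝ :=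
  if h : ∃ z, IsExtremalFrom α x₀ p₀ z then (h.choose t).1 else x₀

/-- The exponential map `exp_{x⁰}(p⁰) = γ(1; p⁰)`. -/
noncomputable def expMap (α : Fin n → ℕ) (x₀ p₀ : Fin (n + 1) → ℝ) : Fin (n + 1) → ℝ :=
  geodesic α x₀ p₀ 1

/-! Generalized spherical coordinates on `H_{x⁰}^{-1}(1/2)`. -/

/-- The rectangle `(∏_{j ≤ n-1} [0, π_{α̃_j}]) × [0, 2 π_{α̃_n})`. -/
def coordRect (α : Fin n → ℕ) : Set (Fin n → ℝ) :=
  {φ | ∀ j : Fin n, if (j : ℕ) + 1 = n then φ j ∈ Set.Ico 0 (2 * piT (α j))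
    else φ j ∈ Set.Icc 0 (piT (α j))}

/-- `R⁰_α`: the points of the rectangle with `sin_{α̃_j}(φ_j) ≠ 0` for all `j`. -/
def coordRect₀ (α : Fin n → ℕ) : Set (Fin n → ℝ) :=
  {φ | φ ∈ coordRect α ∧ ∀ j, sinT (α j) (φ j) ≠ 0}

/-- `δ_j = ρ_{α_j}(sin_{α_j}(φ_j) / x⁰_j)` if `α_j ≠ 0`, and `δ_j = sin φ_j` otherwise. -/
noncomputable def delta (α : Fin n → ℕ) (x₀ : Fin (n + 1) → ℝ) (φ : Fin n → ℝ) (j : Fin n) : ℝ :=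
  if α j = 0 then Real.sin (φ j) else rho (α j) (genSin (α j) (φ j) / x₀ j.castSucc)

/-- The covector `p⁰(φ)`: `p⁰_j = cos_{α̃_j}(φ_j) ∏_{i < j} δ_i` for `j ≤ n`, and
`p⁰_{n+1} = ∏_{i ≤ n} δ_i`. -/
noncomputable def covector (α : Fin n → ℕ) (x₀ : Fin (n + 1) → ℝ) (φ : Fin n → ℝ) :
    Fin (n + 1) → ℝ :=
  Fin.snoc (α := fun _ => ℝ)
    (fun j : Fin n => cosT (α j) (φ j) * ∏ i : Fin n with i < j, delta α x₀ φ i)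
    (∏ i, delta α x₀ φ i)

/-- The map `(t, φ) ↦ exp_{x⁰}(t p⁰(φ))`, with `(t, φ)` packed as `(t, φ_1, …, φ_n) ∈ ℝ^{n+1}`. -/
noncomputable def expCoord (α : Fin n → ℕ) (x₀ : Fin (n + 1) → ℝ) (y : Fin (n + 1) → ℝ) :
    Fin (n + 1) → ℝ :=
  expMap α x₀ (y 0 • covector α x₀ (Fin.tail y))

/-- `D(t, φ)`: the Jacobian determinant of `(t, φ_1, …, φ_n) ↦ exp_{x⁰}(t p⁰(φ))`. -/
noncomputable def jacobianDet (α : Fin n → ℕ) (x₀ : Fin (n + 1) → ℝ) (t : ℝ) (φ : Fin n → ℝ) : ℝ :=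
  Matrix.det (Matrix.of fun k l : Fin (n + 1) =>
    fderiv ℝ (expCoord α x₀) (Fin.cons t φ) (Pi.single l 1) k)

/-- `∫₀ᵗ ξ_j(x(s))² ds` along the geodesic `x(s)` with initial covector `p⁰(φ)`. -/
noncomputable def xiInt (α : Fin n → ℕ) (x₀ : Fin (n + 1) → ℝ) (φ : Fin n → ℝ) (j : Fin n)
    (t : ℝ) : ℝ :=
  ∫ s in (0 : ℝ)..t, xi α j.castSucc (geodesic α x₀ (covector α x₀ φ) s) ^ 2

/-- `ω_j = (sin_{α_j}(φ_j) / x⁰_j) ∏_{i < j} δ_i`, for `α_j ≠ 0`. -/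
noncomputable def omega (α : Fin n → ℕ) (x₀ : Fin (n + 1) → ℝ) (φ : Fin n → ℝ) (j : Fin n) : ℝ :=
  genSin (α j) (φ j) / x₀ j.castSucc * ∏ i : Fin n with i < j, delta α x₀ φ i

/-- `Q_j = ω_j ∫₀ᵗ ξ_j² ds + φ_j`, for `α_j ≠ 0`. -/
noncomputable def Qfun (α : Fin n → ℕ) (x₀ : Fin (n + 1) → ℝ) (φ : Fin n → ℝ) (j : Fin n)
    (t : ℝ) : ℝ :=
  omega α x₀ φ j * xiInt α x₀ φ j t + φ j

/-- The factor `S_j(t, φ)`. -/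
noncomputable def Sfun (α : Fin n → ℕ) (x₀ : Fin (n + 1) → ℝ) (φ : Fin n → ℝ) (j : Fin n)
    (t : ℝ) : ℝ :=
  if α j = 0 then xiInt α x₀ φ j t
  else genCos (α j) (Qfun α x₀ φ j t)
        * (genCot (α j) (φ j) * (omega α x₀ φ j * xiInt α x₀ φ j t) + 1)
      - genCot (α j) (φ j) * genSin (α j) (Qfun α x₀ φ j t)

/-- The factor `g(φ) = (-1)^{|J|} (∏_{j ∉ J} ∏_{i < j} δ_i) ∏_{j ∈ J} |x⁰_j / sin_{α_j}(φ_j)|^{α_j+1}`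
with `J = {j ≤ n : α_j ≠ 0}`. -/
noncomputable def gfun (α : Fin n → ℕ) (x₀ : Fin (n + 1) → ℝ) (φ : Fin n → ℝ) : ℝ :=
  (-1) ^ (Finset.univ.filter fun j : Fin n => α j ≠ 0).card
    * (∏ j : Fin n with α j = 0, ∏ i : Fin n with i < j, delta α x₀ φ i)
    * ∏ j : Fin n with α j ≠ 0, |x₀ j.castSucc / genSin (α j) (φ j)| ^ (α j + 1)

end Grushin

namespace Grushin

open Filter Topology

/-! Run the coordinate `x_i` in its own time `τ_i = ∫ ξ_i²` and put `P_j = ∏_{i<j} δ_i`. Hamilton's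
equations become `dx_i/dτ_i = p_i`, `dp_i/dτ_i = -α_i x_i^(2α_i-1) P_{i+1}²`, because the energy
carried by the coordinates from `j` on, divided by `ξ_j²`, is the constant `P_j²`
(`momentum_sq_add`, `energy_sum`). For `α_i ≠ 0` this is the equation of the generalized sine,
solved by `x_i = (x⁰_i / sin φ_i) sin(ω_i τ_i + φ_i)`; for `α_i = 0` the motion is linear in `τ_i`.
As `ξ_{i+1}² = ξ_i² x_i^(2α_i)`, the coordinates are integrated one after another. This gives a
global solution, smooth in `(t, φ)` where no sine vanishes (`isExtremalFrom_sol`,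
`contDiffOn_solPos`). It is unique since the vector field is locally Lipschitz.

Two facts determine the determinant. First, `x_i` depends only on `t` and `φ_1, …, φ_i`, so the
entries `∂x_i/∂φ_l` with `i < l` vanish. Second, `⟨p, x'⟩ = 2H = 1`, while `⟨p, ∂x/∂φ_l⟩` is
constant in time and vanishes at `t = 0`, the starting point being fixed. Hence the combination of
the rows with coefficients `p_k` is `(1, 0, …, 0)`. Putting it in place of the last row leaves a
triangular minor: `p_{n+1} D = (-1)^n ∏ ∂x_i/∂φ_i` (`det_of_vecMul_eq_single`).

Each diagonal entry is `S_i` times an explicit prefactor (`fderiv_solPos_diag`). Since `p_{n+1} = ∏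
δ_i` is nonzero it can be cancelled, and the prefactors combine to `g` (`prod_delta_mul_gfun`). -/

/-! ### The integral `F_a` on `[-1, 1]` -/

theorem one_sub_pow_pos {a : ℕ} (ha : a ≠ 0) {s : ℝ} (hs : s ∈ Set.Ioo (-1 : ℝ) 1) :
    0 < 1 - s ^ (2 * a) := by
  have h : s ^ 2 < 1 := by nlinarith [hs.1, hs.2]
  rw [pow_mul]
  linarith [pow_lt_one₀ (sq_nonneg s) h ha]

/-- On `[-1, 1]` one has `s^(2a) ≤ s²`, so the singular integrand is dominated by the derivative of
arcsine, which is integrable as a nonnegative derivative of a continuous function. -/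
theorem intervalIntegrable_genF_integrand {a : ℕ} (ha : a ≠ 0) :
    IntervalIntegrable (fun s : ℝ => 1 / Real.sqrt (1 - s ^ (2 * a))) MeasureTheory.volume
      (-1) 1 := by
  have h : IntervalIntegrable (fun s : ℝ => 1 / Real.sqrt (1 - s ^ 2)) MeasureTheory.volume
      (-1) 1 := by
    refine intervalIntegral.intervalIntegrable_deriv_of_nonneg (g := Real.arcsin)
      Real.continuous_arcsin.continuousOn ?_ ?_
    · intro x hx
      norm_num at hx
      exact Real.hasDerivAt_arcsin (by linarith) (by linarith)
    · intro x _
      positivity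
  refine h.mono_fun (Measurable.aestronglyMeasurable (by fun_prop)) ?_
  rw [Set.uIoc_of_le (by norm_num)]
  have : ∀ᵐ x : ℝ ∂MeasureTheory.volume, x ≠ 1 := by
    simp [MeasureTheory.ae_iff, MeasureTheory.measure_singleton]
  filter_upwards [MeasureTheory.ae_restrict_of_ae this,
    MeasureTheory.ae_restrict_mem measurableSet_Ioc] with s hs1 hs
  have hs' : s ∈ Set.Ioo (-1 : ℝ) 1 := ⟨hs.1, lt_of_le_of_ne hs.2 hs1⟩
  have h2 : s ^ 2 < 1 := by nlinarith [hs'.1, hs'.2]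
  have h3 : s ^ (2 * a) ≤ s ^ 2 := by
    rw [pow_mul]
    exact pow_le_of_le_one (sq_nonneg s) h2.le ha
  rw [Real.norm_of_nonneg (by positivity), Real.norm_of_nonneg (by positivity)]
  exact one_div_le_one_div_of_le (Real.sqrt_pos.2 (by linarith))
    (Real.sqrt_le_sqrt (by linarith))

theorem hasDerivAt_genF {a : ℕ} (ha : a ≠ 0) {x : ℝ} (hx : x ∈ Set.Ioo (-1 : ℝ) 1) :
    HasDerivAt (genF a) (1 / Real.sqrt (1 - x ^ (2 * a))) x := by
  have hc : ContinuousAt (fun s : ℝ => 1 / Real.sqrt (1 - s ^ (2 * a))) x := by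
    refine ContinuousAt.div continuousAt_const (by fun_prop) ?_
    exact (Real.sqrt_pos.2 (one_sub_pow_pos ha hx)).ne'
  refine intervalIntegral.integral_hasDerivAt_right ?_ ?_ hc
  · refine (intervalIntegrable_genF_integrand ha).mono_set ?_
    rw [Set.uIcc_of_le (by norm_num : (-1 : ℝ) ≤ 1)]
    exact Set.uIcc_subset_Icc (by norm_num) ⟨hx.1.le, hx.2.le⟩
  · exact (Measurable.stronglyMeasurable (by fun_prop)).stronglyMeasurableAtFilter

theorem continuousOn_genF {a : ℕ} (ha : a ≠ 0) : ContinuousOn (genF a) (Set.Icc (-1) 1) := by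
  have := intervalIntegral.continuousOn_primitive_interval' (a := 0)
    (intervalIntegrable_genF_integrand ha) (by rw [Set.uIcc_of_le] <;> norm_num)
  rwa [Set.uIcc_of_le (by norm_num)] at this

theorem strictMonoOn_genF {a : ℕ} (ha : a ≠ 0) : StrictMonoOn (genF a) (Set.Icc (-1) 1) := by
  refine strictMonoOn_of_deriv_pos (convex_Icc _ _) (continuousOn_genF ha) ?_
  intro x hx
  rw [interior_Icc] at hx
  rw [(hasDerivAt_genF ha hx).deriv]
  exact one_div_pos.2 (Real.sqrt_pos.2 (one_sub_pow_pos ha hx))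

@[simp] theorem genF_zero (a : ℕ) : genF a 0 = 0 := by simp [genF]

theorem genF_neg (a : ℕ) (x : ℝ) : genF a (-x) = -genF a x := by
  unfold genF
  have := intervalIntegral.integral_comp_neg (a := 0) (b := x)
    (fun s : ℝ => 1 / Real.sqrt (1 - s ^ (2 * a)))
  simp only [(even_two_mul a).neg_pow, neg_zero] at this
  rw [this, intervalIntegral.integral_symm]

theorem genPi_pos {a : ℕ} (ha : a ≠ 0) : 0 < genPi a := by
  have := strictMonoOn_genF ha (by norm_num : (0 : ℝ) ∈ Set.Icc (-1 : ℝ) 1)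
    (by norm_num : (1 : ℝ) ∈ Set.Icc (-1 : ℝ) 1) one_pos
  rw [genF_zero] at this
  unfold genPi
  linarith

/-! ### The generalized sine on the real line: periods and symmetries -/

theorem genSinQuarter_spec {a : ℕ} (ha : a ≠ 0) {y : ℝ} (hy : y ∈ Set.Icc 0 (genPi a / 2)) :
    genSinQuarter a y ∈ Set.Icc (0 : ℝ) 1 ∧ genF a (genSinQuarter a y) = y := by
  have h : y ∈ genF a '' Set.Icc 0 1 := by
    refine intermediate_value_Icc zero_le_one
      ((continuousOn_genF ha).mono (Set.Icc_subset_Icc_left (by norm_num))) ?_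
    rw [genF_zero]
    refine ⟨hy.1, hy.2.trans_eq ?_⟩
    unfold genPi
    ring
  exact ⟨Function.invFunOn_mem h, Function.invFunOn_eq h⟩

theorem genSinQuarter_zero {a : ℕ} (ha : a ≠ 0) : genSinQuarter a 0 = 0 := by
  obtain ⟨h1, h2⟩ := genSinQuarter_spec ha (y := 0) ⟨le_rfl, by linarith [genPi_pos ha]⟩
  refine (strictMonoOn_genF ha).injOn ⟨by linarith [h1.1], h1.2⟩ (by norm_num) ?_
  rw [h2, genF_zero]

/-- The restriction of `sin_α` to the fundamental domain `[-π_α, π_α]`. -/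
noncomputable def genSinBase (a : ℕ) (r : ℝ) : ℝ :=
  Real.sign r * genSinQuarter a (min |r| (genPi a - |r|))

/-- Frees the sine from the particular representative chosen by `round`. Two distinct
representatives of modulus at most `π_a` differ by at least `2π_a`, so both are `±π_a`, where the
base function vanishes. -/
theorem genSin_eq_base {a : ℕ} (ha : a ≠ 0) {r : ℝ} (hr : |r| ≤ genPi a) (k : ℤ) :
    genSin a (r + 2 * genPi a * k) = genSinBase a r := by
  have hp := genPi_pos ha
  have hbase : ∀ s : ℝ, |s| = genPi a → genSinBase a s = 0 := by
    intro s hs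
    simp [genSinBase, hs, hp.le, genSinQuarter_zero ha]
  set y := r + 2 * genPi a * k with hy
  have hg : genSin a y = genSinBase a (y - 2 * genPi a * (round (y / (2 * genPi a)) : ℝ)) := rfl
  have hround := abs_sub_round (y / (2 * genPi a))
  set m : ℤ := round (y / (2 * genPi a)) with hm
  have hs : |y - 2 * genPi a * m| ≤ genPi a := by
    have : y - 2 * genPi a * m = 2 * genPi a * (y / (2 * genPi a) - m) := by field_simp
    rw [this, abs_mul, abs_of_pos (by positivity)]
    nlinarith
  rw [hg]
  rcases eq_or_ne k m with h | h
  · rw [hy, h]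
    congr 1
    ring
  · have h1 : (1 : ℝ) ≤ |(k : ℝ) - m| := by
      have : (1 : ℤ) ≤ |k - m| := Int.one_le_abs (sub_ne_zero.2 h)
      exact_mod_cast this
    have h2 : 2 * genPi a * |(k : ℝ) - m| ≤ |y - 2 * genPi a * m| + |r| := by
      have : 2 * genPi a * ((k : ℝ) - m) = (y - 2 * genPi a * m) - r := by rw [hy]; ring
      have h3 := norm_sub_le (y - 2 * genPi a * m) r
      rwa [← this, norm_mul, Real.norm_of_nonneg (by positivity)] at h3
    have h3 : 2 * genPi a ≤ 2 * genPi a * |(k : ℝ) - m| := by nlinarith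
    rw [hbase _ (by linarith), hbase r (by linarith)]

theorem exists_eq_add_period {p : ℝ} (hp : 0 < p) (y : ℝ) :
    ∃ r : ℝ, ∃ k : ℤ, -(p / 2) ≤ r ∧ r < p / 2 ∧ y = r + p * k := by
  obtain ⟨k, hk, -⟩ := existsUnique_sub_zsmul_mem_Ico hp y (-(p / 2))
  refine ⟨y - k • p, k, hk.1, by linarith [hk.2], ?_⟩
  rw [zsmul_eq_mul]
  ring

/-- A shift by `π_a` in the direction opposite to the sign of `r` exchanges `|r|` and `π_a - |r|`,
which the minimum ignores, and reverses the sign. At `r = 0` and `r = -π_a` both sides are zero. -/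
theorem genSin_add_genPi {a : ℕ} (ha : a ≠ 0) (y : ℝ) :
    genSin a (y + genPi a) = -genSin a y := by
  have hp := genPi_pos ha
  obtain ⟨r, k, h1, h2, rfl⟩ := exists_eq_add_period (p := 2 * genPi a) (by linarith) y
  rw [genSin_eq_base ha (abs_le.2 ⟨by linarith, by linarith⟩)]
  rcases le_or_gt r 0 with hr | hr
  · have : r + 2 * genPi a * k + genPi a = (r + genPi a) + 2 * genPi a * k := by ring
    rw [this, genSin_eq_base ha (abs_le.2 ⟨by linarith, by linarith⟩)]
    unfold genSinBase
    rw [abs_of_nonpos hr, abs_of_nonneg (by linarith : 0 ≤ r + genPi a), min_comm]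
    have e1 : genPi a - (r + genPi a) = -r := by ring
    have e2 : genPi a - -r = r + genPi a := by ring
    rw [e1, e2]
    rcases hr.lt_or_eq with hr | rfl
    · rcases (by linarith : -genPi a ≤ r).lt_or_eq with h | h
      · rw [Real.sign_of_pos (by linarith), Real.sign_of_neg hr]; ring
      · rw [← h]; simp [hp.le, genSinQuarter_zero ha]
    · simp [hp.le, genSinQuarter_zero ha]
  · have : r + 2 * genPi a * k + genPi a = (r - genPi a) + 2 * genPi a * ((k + 1 : ℤ) : ℝ) := by
      push_cast; ring
    rw [this, genSin_eq_base ha (abs_le.2 ⟨by linarith, by linarith⟩)]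
    unfold genSinBase
    rw [abs_of_pos hr, abs_of_nonpos (by linarith : r - genPi a ≤ 0), min_comm,
      Real.sign_of_pos hr, Real.sign_of_neg (by linarith)]
    have e1 : genPi a - -(r - genPi a) = r := by ring
    have e2 : -(r - genPi a) = genPi a - r := by ring
    rw [e1, e2]; ring

theorem genSin_neg {a : ℕ} (ha : a ≠ 0) (y : ℝ) : genSin a (-y) = -genSin a y := by
  have hp := genPi_pos ha
  obtain ⟨r, k, h1, h2, rfl⟩ := exists_eq_add_period (p := 2 * genPi a) (by linarith) y
  have hr : |r| ≤ genPi a := abs_le.2 ⟨by linarith, by linarith⟩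
  have : -(r + 2 * genPi a * k) = -r + 2 * genPi a * ((-k : ℤ) : ℝ) := by push_cast; ring
  rw [this, genSin_eq_base ha hr, genSin_eq_base ha (by rwa [abs_neg])]
  simp [genSinBase, Real.sign_neg]

theorem genSin_genPi_sub {a : ℕ} (ha : a ≠ 0) (y : ℝ) :
    genSin a (genPi a - y) = genSin a y := by
  rw [show genPi a - y = -y + genPi a by ring, genSin_add_genPi ha, genSin_neg ha, neg_neg]

theorem genSin_add_int_mul {a : ℕ} (ha : a ≠ 0) (y : ℝ) (k : ℤ) :
    genSin a (y + genPi a * k) = (-1) ^ k * genSin a y := by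
  induction k using Int.induction_on with
  | zero => simp
  | succ k ih =>
    rw [zpow_add_one₀ (by norm_num)]
    push_cast at ih ⊢
    rw [show y + genPi a * (k + 1) = (y + genPi a * k) + genPi a by ring, genSin_add_genPi ha, ih]
    ring
  | pred k ih =>
    have := genSin_add_genPi ha (y + genPi a * ((-k - 1 : ℤ) : ℝ))
    rw [show y + genPi a * ((-k - 1 : ℤ) : ℝ) + genPi a = y + genPi a * ((-k : ℤ) : ℝ) by
      push_cast; ring, ih] at this
    rw [zpow_sub_one₀ (by norm_num), ← neg_eq_iff_eq_neg.2 this]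
    norm_num

theorem genSin_spec {a : ℕ} (ha : a ≠ 0) {y : ℝ}
    (hy : y ∈ Set.Icc (-(genPi a / 2)) (genPi a / 2)) :
    genSin a y ∈ Set.Icc (-1 : ℝ) 1 ∧ genF a (genSin a y) = y := by
  have hp := genPi_pos ha
  have key : ∀ y ∈ Set.Icc 0 (genPi a / 2),
      genSin a y ∈ Set.Icc (-1 : ℝ) 1 ∧ genF a (genSin a y) = y := by
    intro y hy
    have h := genSin_eq_base ha (r := y) (abs_le.2 ⟨by linarith [hy.1], by linarith [hy.2]⟩) 0
    have h' : genSin a y = genSinQuarter a y := by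
      rw [Int.cast_zero, mul_zero, add_zero] at h
      rw [h, genSinBase, abs_of_nonneg hy.1, min_eq_left (by linarith [hy.2])]
      rcases hy.1.lt_or_eq with h0 | rfl
      · rw [Real.sign_of_pos h0, one_mul]
      · simp [genSinQuarter_zero ha]
    rw [h']
    obtain ⟨h1, h2⟩ := genSinQuarter_spec ha hy
    exact ⟨⟨by linarith [h1.1], h1.2⟩, h2⟩
  rcases le_total 0 y with h | h
  · exact key y ⟨h, hy.2⟩
  · obtain ⟨h1, h2⟩ := key (-y) ⟨by linarith, by linarith [hy.1]⟩
    rw [genSin_neg ha] at h1 h2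
    rw [genF_neg] at h2
    exact ⟨⟨by linarith [h1.2], by linarith [h1.1]⟩, by linarith⟩

theorem genF_mem {a : ℕ} (ha : a ≠ 0) {x : ℝ} (hx : x ∈ Set.Icc (-1 : ℝ) 1) :
    genF a x ∈ Set.Icc (-(genPi a / 2)) (genPi a / 2) := by
  have h1 : genF a 1 = genPi a / 2 := by unfold genPi; ring
  have h2 : genF a (-1) = -(genPi a / 2) := by rw [genF_neg, h1]
  have hm := (strictMonoOn_genF ha).monotoneOn
  exact ⟨h2 ▸ hm (by norm_num) hx hx.1, h1 ▸ hm hx (by norm_num) hx.2⟩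

theorem genSin_genF {a : ℕ} (ha : a ≠ 0) {x : ℝ} (hx : x ∈ Set.Icc (-1 : ℝ) 1) :
    genSin a (genF a x) = x := by
  obtain ⟨h1, h2⟩ := genSin_spec ha (genF_mem ha hx)
  exact (strictMonoOn_genF ha).injOn h1 hx h2

theorem genSin_half_genPi {a : ℕ} (ha : a ≠ 0) : genSin a (genPi a / 2) = 1 := by
  have h1 : genF a 1 = genPi a / 2 := by unfold genPi; ring
  rw [← h1, genSin_genF ha (by norm_num)]

theorem strictMonoOn_genSin {a : ℕ} (ha : a ≠ 0) :
    StrictMonoOn (genSin a) (Set.Icc (-(genPi a / 2)) (genPi a / 2)) := by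
  intro x hx y hy hxy
  obtain ⟨h1, h2⟩ := genSin_spec ha hx
  obtain ⟨h3, h4⟩ := genSin_spec ha hy
  rwa [← (strictMonoOn_genF ha).lt_iff_lt h1 h3, h2, h4]

theorem image_genSin {a : ℕ} (ha : a ≠ 0) :
    genSin a '' Set.Icc (-(genPi a / 2)) (genPi a / 2) = Set.Icc (-1) 1 := by
  apply Set.Subset.antisymm
  · rintro _ ⟨y, hy, rfl⟩
    exact (genSin_spec ha hy).1
  · intro x hx
    exact ⟨genF a x, genF_mem ha hx, genSin_genF ha hx⟩

/-! ### Derivatives and smoothness of the generalized sine and cosine -/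

theorem genSin_mem_Ioo {a : ℕ} (ha : a ≠ 0) {y : ℝ}
    (hy : y ∈ Set.Ioo (-(genPi a / 2)) (genPi a / 2)) : genSin a y ∈ Set.Ioo (-1 : ℝ) 1 := by
  have hp := genPi_pos ha
  have h1 := strictMonoOn_genSin ha ⟨hy.1.le, hy.2.le⟩ (Set.right_mem_Icc.2 (by linarith)) hy.2
  have h2 := strictMonoOn_genSin ha (Set.left_mem_Icc.2 (by linarith)) ⟨hy.1.le, hy.2.le⟩ hy.1
  rw [genSin_half_genPi ha] at h1
  rw [genSin_neg ha, genSin_half_genPi ha] at h2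
  exact ⟨h2, h1⟩

theorem hasDerivAt_genSin_of_mem_Ioo {a : ℕ} (ha : a ≠ 0) {y : ℝ}
    (hy : y ∈ Set.Ioo (-(genPi a / 2)) (genPi a / 2)) :
    HasDerivAt (genSin a) (Real.sqrt (1 - genSin a y ^ (2 * a))) y := by
  have hm := genSin_mem_Ioo ha hy
  have hc : ContinuousAt (genSin a) y := by
    refine (strictMonoOn_genSin ha).continuousAt_of_image_mem_nhds (Icc_mem_nhds hy.1 hy.2) ?_
    rw [image_genSin ha]
    exact Icc_mem_nhds hm.1 hm.2
  have := HasDerivAt.of_local_left_inverse hc (hasDerivAt_genF ha hm)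
    (one_div_pos.2 (Real.sqrt_pos.2 (one_sub_pow_pos ha hm))).ne' ?_
  · simpa using this
  · filter_upwards [Ioo_mem_nhds hy.1 hy.2] with z hz
    exact (genSin_spec ha ⟨hz.1.le, hz.2.le⟩).2

theorem continuousWithinAt_genSin_left {a : ℕ} (ha : a ≠ 0) :
    ContinuousWithinAt (genSin a) (Set.Iic (genPi a / 2)) (genPi a / 2) := by
  have hp := genPi_pos ha
  refine (strictMonoOn_genSin ha).continuousWithinAt_left_of_image_mem_nhdsWithin
    (Icc_mem_nhdsLE (by linarith)) ?_
  rw [image_genSin ha, genSin_half_genPi ha]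
  exact Icc_mem_nhdsLE (by norm_num)

/-- The inverse function rule fails here, since the derivative of `F_a` blows up at `1`. The left
derivative is instead the limit of `√(1 - sin^(2a))`, and the right one follows from the reflection
`y ↦ π_a - y`. -/
theorem hasDerivAt_genSin_half_genPi {a : ℕ} (ha : a ≠ 0) :
    HasDerivAt (genSin a) 0 (genPi a / 2) := by
  have hp := genPi_pos ha
  have hleft : HasDerivWithinAt (genSin a) 0 (Set.Iic (genPi a / 2)) (genPi a / 2) := by
    refine hasDerivWithinAt_Iic_of_tendsto_deriv
      (s := Set.Ioo (-(genPi a / 2)) (genPi a / 2)) ?_ ?_ (Ioo_mem_nhdsLT (by linarith)) ?_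
    · exact fun y hy =>
        (hasDerivAt_genSin_of_mem_Ioo ha hy).differentiableAt.differentiableWithinAt
    · exact (continuousWithinAt_genSin_left ha).mono fun y hy => hy.2.le
    · have h1 : Tendsto (fun y => Real.sqrt (1 - genSin a y ^ (2 * a))) (𝓝[<] (genPi a / 2))
          (𝓝 0) := by
        have h2 : Tendsto (genSin a) (𝓝[<] (genPi a / 2)) (𝓝 1) := by
          have := (continuousWithinAt_genSin_left ha).mono Set.Iio_subset_Iic_self
          rwa [ContinuousWithinAt, genSin_half_genPi ha] at this
        have := (tendsto_const_nhds (x := (1 : ℝ))).sub (h2.pow (2 * a))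
        simpa [Function.comp_def] using (Real.continuous_sqrt.tendsto _).comp this
      refine h1.congr' ?_
      filter_upwards [Ioo_mem_nhdsLT (by linarith : -(genPi a / 2) < genPi a / 2)] with y hy
      exact (hasDerivAt_genSin_of_mem_Ioo ha hy).deriv.symm
  have hright : HasDerivWithinAt (genSin a) 0 (Set.Ici (genPi a / 2)) (genPi a / 2) := by
    have hsub : HasDerivWithinAt (fun y => genPi a - y) (-1) (Set.Ici (genPi a / 2))
        (genPi a / 2) := ((hasDerivAt_id _).const_sub (genPi a)).hasDerivWithinAt
    have hl : HasDerivWithinAt (genSin a) 0 (Set.Iic (genPi a / 2))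
        (genPi a - genPi a / 2) := by
      rwa [show genPi a - genPi a / 2 = genPi a / 2 by ring]
    have := hl.scomp (genPi a / 2) hsub
      (fun y (hy : genPi a / 2 ≤ y) => (by linarith : genPi a - y ≤ genPi a / 2))
    simp only [smul_zero] at this
    refine this.congr_of_mem (fun y _ => ?_) Set.self_mem_Ici
    exact (genSin_genPi_sub ha y).symm
  have := hleft.union hright
  rwa [Set.Iic_union_Ici, hasDerivWithinAt_univ] at this

theorem exists_eq_add_genPi {a : ℕ} (ha : a ≠ 0) (y : ℝ) :
    ∃ r ∈ Set.Ioc (-(genPi a / 2)) (genPi a / 2), ∃ k : ℤ, y = r + genPi a * k := by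
  obtain ⟨r, k, h1, h2, h⟩ := exists_eq_add_period (genPi_pos ha) (-y)
  refine ⟨-r, ⟨by linarith, by linarith⟩, -k, ?_⟩
  push_cast
  linarith

theorem hasDerivAt_genSin_add_int_mul {a : ℕ} (ha : a ≠ 0) {r : ℝ} {c : ℝ} (k : ℤ)
    (h : HasDerivAt (genSin a) c r) :
    HasDerivAt (genSin a) ((-1) ^ k * c) (r + genPi a * k) := by
  have h1 : HasDerivAt (fun y => (-1) ^ k * genSin a (y - genPi a * k)) ((-1) ^ k * c)
      (r + genPi a * k) := by
    refine HasDerivAt.const_mul _ (HasDerivAt.comp_sub_const _ _ ?_)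
    rwa [add_sub_cancel_right]
  convert h1 using 1
  ext y
  rw [← genSin_add_int_mul ha, sub_add_cancel]

theorem hasDerivAt_genSin {a : ℕ} (ha : a ≠ 0) (y : ℝ) :
    HasDerivAt (genSin a) (genCos a y) y := by
  obtain ⟨r, hr, k, rfl⟩ := exists_eq_add_genPi ha y
  have : DifferentiableAt ℝ (genSin a) r := by
    rcases hr.2.lt_or_eq with h | rfl
    · exact (hasDerivAt_genSin_of_mem_Ioo ha ⟨hr.1, h⟩).differentiableAt
    · exact (hasDerivAt_genSin_half_genPi ha).differentiableAt
  exact (hasDerivAt_genSin_add_int_mul ha k this.hasDerivAt).differentiableAt.hasDerivAt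

theorem genCos_add_int_mul {a : ℕ} (ha : a ≠ 0) (y : ℝ) (k : ℤ) :
    genCos a (y + genPi a * k) = (-1) ^ k * genCos a y :=
  (hasDerivAt_genSin_add_int_mul ha k (hasDerivAt_genSin ha y)).deriv

theorem genCos_of_mem_Ioo {a : ℕ} (ha : a ≠ 0) {y : ℝ}
    (hy : y ∈ Set.Ioo (-(genPi a / 2)) (genPi a / 2)) :
    genCos a y = Real.sqrt (1 - genSin a y ^ (2 * a)) :=
  (hasDerivAt_genSin_of_mem_Ioo ha hy).deriv

theorem genCos_half_genPi {a : ℕ} (ha : a ≠ 0) : genCos a (genPi a / 2) = 0 :=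
  (hasDerivAt_genSin_half_genPi ha).deriv

theorem genCos_sq_add_genSin_pow {a : ℕ} (ha : a ≠ 0) (y : ℝ) :
    genCos a y ^ 2 + genSin a y ^ (2 * a) = 1 := by
  obtain ⟨r, hr, k, rfl⟩ := exists_eq_add_genPi ha y
  have hk : ((-1 : ℝ) ^ k) ^ 2 = 1 := by
    rw [← zpow_natCast, ← zpow_mul]
    exact (even_two.mul_left k).neg_one_zpow
  rw [genCos_add_int_mul ha, genSin_add_int_mul ha, mul_pow, mul_pow, pow_mul, hk, one_pow,
    one_mul, one_mul]
  rcases hr.2.lt_or_eq with h | rfl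
  · rw [genCos_of_mem_Ioo ha ⟨hr.1, h⟩, Real.sq_sqrt
      (one_sub_pow_pos ha (genSin_mem_Ioo ha ⟨hr.1, h⟩)).le]
    ring
  · simp [genCos_half_genPi ha, genSin_half_genPi ha]

theorem continuous_genSin {a : ℕ} (ha : a ≠ 0) : Continuous (genSin a) :=
  continuous_iff_continuousAt.2 fun y => (hasDerivAt_genSin ha y).continuousAt

/-- Differentiating `√(1 - sin^(2a))` produces a factor `cos / cos`, which cancels because the
cosine is positive on the open interval. -/
theorem hasDerivAt_genCos_of_mem_Ioo {a : ℕ} (ha : a ≠ 0) {y : ℝ}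
    (hy : y ∈ Set.Ioo (-(genPi a / 2)) (genPi a / 2)) :
    HasDerivAt (genCos a) (-a * genSin a y ^ (2 * a - 1)) y := by
  have hpos := one_sub_pow_pos ha (genSin_mem_Ioo ha hy)
  have h := (((hasDerivAt_genSin ha y).pow (2 * a)).const_sub 1).sqrt hpos.ne'
  have hne : genCos a y ≠ 0 := by
    rw [genCos_of_mem_Ioo ha hy]
    exact (Real.sqrt_pos.2 hpos).ne'
  refine (h.congr_of_eventuallyEq ?_).congr_deriv ?_
  · filter_upwards [Ioo_mem_nhds hy.1 hy.2] with z hz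
    exact genCos_of_mem_Ioo ha hz
  · simp only [Pi.pow_apply]
    rw [← genCos_of_mem_Ioo ha hy]
    push_cast
    field_simp

theorem hasDerivAt_genCos_add_int_mul {a : ℕ} (ha : a ≠ 0) {r : ℝ} (k : ℤ)
    (h : HasDerivAt (genCos a) (-a * genSin a r ^ (2 * a - 1)) r) :
    HasDerivAt (genCos a) (-a * genSin a (r + genPi a * k) ^ (2 * a - 1)) (r + genPi a * k) := by
  have h1 : HasDerivAt (fun y => (-1) ^ k * genCos a (y - genPi a * k))
      ((-1) ^ k * (-a * genSin a r ^ (2 * a - 1))) (r + genPi a * k) := by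
    refine HasDerivAt.const_mul _ (HasDerivAt.comp_sub_const _ _ ?_)
    rwa [add_sub_cancel_right]
  convert h1 using 1
  · ext y
    rw [← genCos_add_int_mul ha, sub_add_cancel]
  · have hk : ((-1 : ℝ) ^ k) ^ (2 * a - 1) = (-1) ^ k := by
      have hodd : Odd (2 * a - 1) := by
        obtain ⟨b, rfl⟩ := Nat.exists_eq_succ_of_ne_zero ha
        exact ⟨b, by omega⟩
      rcases Int.even_or_odd k with h | h <;> simp [h.neg_one_zpow, hodd.neg_one_pow]
    rw [genSin_add_int_mul ha, mul_pow, hk]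
    ring

/-- The square root is not differentiable at its zero, but the formula for the derivative holds on
both sides of `π_a / 2` and extends continuously to it, which suffices. -/
theorem hasDerivAt_genCos_half_genPi {a : ℕ} (ha : a ≠ 0) :
    HasDerivAt (genCos a) (-a * genSin a (genPi a / 2) ^ (2 * a - 1)) (genPi a / 2) := by
  have hp := genPi_pos ha
  have hcs := continuous_genSin ha
  have hab : ∀ y, |genCos a y| = Real.sqrt (1 - genSin a y ^ (2 * a)) := fun y => by
    rw [← Real.sqrt_sq_eq_abs, ← genCos_sq_add_genSin_pow ha y]
    ring_nf
  have hcont : ContinuousAt (genCos a) (genPi a / 2) := by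
    rw [ContinuousAt, genCos_half_genPi ha, tendsto_zero_iff_abs_tendsto_zero]
    have : Continuous fun y => Real.sqrt (1 - genSin a y ^ (2 * a)) := by fun_prop
    have h2 := this.tendsto (genPi a / 2)
    rw [genSin_half_genPi ha] at h2
    simp only [one_pow, sub_self, Real.sqrt_zero] at h2
    exact h2.congr fun y => (hab y).symm
  have hI : Set.Ioo (-(genPi a / 2)) (3 * genPi a / 2) ∈ 𝓝 (genPi a / 2) :=
    Ioo_mem_nhds (by linarith) (by linarith)
  have hder : ∀ y ∈ Set.Ioo (-(genPi a / 2)) (3 * genPi a / 2), y ≠ genPi a / 2 →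
      HasDerivAt (genCos a) (-a * genSin a y ^ (2 * a - 1)) y := by
    intro y hy hne
    rcases hne.lt_or_gt with h | h
    · exact hasDerivAt_genCos_of_mem_Ioo ha ⟨hy.1, h⟩
    -- Points to the right of `π_a / 2` are reached from the fundamental interval by one shift by
    -- `π_a`.
    · have := hasDerivAt_genCos_add_int_mul ha 1
        (hasDerivAt_genCos_of_mem_Ioo ha (y := y - genPi a) ⟨by linarith, by linarith [hy.2]⟩)
      simpa using this
  have hg : ContinuousAt (fun y => -a * genSin a y ^ (2 * a - 1)) (genPi a / 2) := by fun_prop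
  rw [← hasDerivWithinAt_univ, ← Set.Iic_union_Ici (a := genPi a / 2)]
  refine HasDerivWithinAt.union ?_ ?_
  · refine hasDerivWithinAt_Iic_of_tendsto_deriv
      (s := Set.Ioo (-(genPi a / 2)) (genPi a / 2)) ?_ hcont.continuousWithinAt
      (Ioo_mem_nhdsLT (by linarith)) ?_
    · exact fun y hy => (hder y ⟨hy.1, by linarith [hy.2]⟩
        hy.2.ne).differentiableAt.differentiableWithinAt
    · refine (hg.mono_left nhdsWithin_le_nhds).congr' ?_
      filter_upwards [nhdsWithin_le_nhds hI, self_mem_nhdsWithin] with y hy hy'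
      exact (hder y hy (ne_of_lt hy')).deriv.symm
  · refine hasDerivWithinAt_Ici_of_tendsto_deriv
      (s := Set.Ioo (genPi a / 2) (3 * genPi a / 2)) ?_ hcont.continuousWithinAt
      (Ioo_mem_nhdsGT (by linarith)) ?_
    · exact fun y hy => (hder y ⟨by linarith [hy.1], hy.2⟩
        hy.1.ne').differentiableAt.differentiableWithinAt
    · refine (hg.mono_left nhdsWithin_le_nhds).congr' ?_
      filter_upwards [nhdsWithin_le_nhds hI, self_mem_nhdsWithin] with y hy hy'
      exact (hder y hy (ne_of_gt hy')).deriv.symm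

theorem hasDerivAt_genCos {a : ℕ} (ha : a ≠ 0) (y : ℝ) :
    HasDerivAt (genCos a) (-a * genSin a y ^ (2 * a - 1)) y := by
  obtain ⟨r, hr, k, rfl⟩ := exists_eq_add_genPi ha y
  refine hasDerivAt_genCos_add_int_mul ha k ?_
  rcases hr.2.lt_or_eq with h | rfl
  · exact hasDerivAt_genCos_of_mem_Ioo ha ⟨hr.1, h⟩
  · exact hasDerivAt_genCos_half_genPi ha

/-- The system `sin' = cos`, `cos' = -a sin^(2a-1)` is closed, so regularity of the pair bootstraps.
-/
theorem contDiff_genSin_genCos {a : ℕ} (ha : a ≠ 0) (m : ℕ) :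
    ContDiff ℝ m (genSin a) ∧ ContDiff ℝ m (genCos a) := by
  have hd : deriv (genCos a) = fun y => -a * genSin a y ^ (2 * a - 1) :=
    funext fun y => (hasDerivAt_genCos ha y).deriv
  induction m with
  | zero =>
    simp only [Nat.cast_zero, contDiff_zero]
    exact ⟨continuous_genSin ha,
      continuous_iff_continuousAt.2 fun y => (hasDerivAt_genCos ha y).continuousAt⟩
  | succ m ih =>
    push_cast
    simp only [contDiff_succ_iff_deriv]
    refine ⟨⟨fun y => (hasDerivAt_genSin ha y).differentiableAt, by simp, ih.2⟩,
      fun y => (hasDerivAt_genCos ha y).differentiableAt, by simp, ?_⟩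
    rw [hd]
    exact contDiff_const.mul (ih.1.pow _)

/-! ### Smooth dependence of integrals on parameters -/

section ParametricIntegral

variable {Y F : Type} [NormedAddCommGroup Y] [NormedAddCommGroup F] [NormedSpace ℝ F]

theorem continuousOn_integral_unit {V : Set Y} {K : Y × ℝ → F}
    (hK : ContinuousOn K (V ×ˢ Set.univ)) :
    ContinuousOn (fun y => ∫ u in (0 : ℝ)..1, K (y, u)) V := by
  rw [continuousOn_iff_continuous_domRestrict]
  refine intervalIntegral.continuous_parametric_intervalIntegral_of_continuous'
    (f := fun (y : V) u => K (y, u)) ?_ 0 1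
  exact hK.comp_continuous (by fun_prop) fun z => ⟨z.1.2, trivial⟩

variable [NormedSpace ℝ Y] [ProperSpace Y]

theorem hasFDerivAt_integral_unit {V : Set Y} (hV : IsOpen V) {K : Y × ℝ → F}
    (hK : ContDiffOn ℝ 1 K (V ×ˢ Set.univ)) {y : Y} (hy : y ∈ V) :
    HasFDerivAt (fun y => ∫ u in (0 : ℝ)..1, K (y, u))
      (∫ u in (0 : ℝ)..1, (fderiv ℝ K (y, u)).comp (ContinuousLinearMap.inl ℝ Y ℝ)) y := by
  have hO : IsOpen (V ×ˢ (Set.univ : Set ℝ)) := hV.prod isOpen_univ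
  have hd : ContinuousOn (fun z : Y × ℝ =>
      (fderiv ℝ K z).comp (ContinuousLinearMap.inl ℝ Y ℝ)) (V ×ˢ Set.univ) :=
    (hK.continuousOn_fderiv_of_isOpen hO le_rfl).clm_comp continuousOn_const
  have hsec : ∀ x ∈ V, Continuous fun u : ℝ => K (x, u) := fun x hx =>
    hK.continuousOn.comp_continuous (by fun_prop) fun u => ⟨hx, trivial⟩
  -- A closed ball in `V` is compact, so the partial derivative is bounded on ball times `[0, 1]`;
  -- this constant is the dominating function.
  obtain ⟨r, hr, hrV⟩ := Metric.nhds_basis_closedBall.mem_iff.1 (hV.mem_nhds hy)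
  obtain ⟨C, hC⟩ := ((isCompact_closedBall y r).prod
    (isCompact_Icc (a := (0 : ℝ)) (b := 1))).exists_bound_of_continuousOn
      (hd.mono (Set.prod_mono hrV (Set.subset_univ _)))
  refine intervalIntegral.hasFDerivAt_integral_of_dominated_of_fderiv_le
    (F := fun y u => K (y, u))
    (F' := fun y u => (fderiv ℝ K (y, u)).comp (ContinuousLinearMap.inl ℝ Y ℝ))
    (s := Metric.closedBall y r) (bound := fun _ => C)
    (Metric.closedBall_mem_nhds y hr) ?_ ?_ ?_ ?_ ?_ ?_
  · filter_upwards [hV.mem_nhds hy] with x hx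
    exact (hsec x hx).aestronglyMeasurable
  · exact (hsec y hy).intervalIntegrable _ _
  · exact (hd.comp_continuous (f := fun u : ℝ => (y, u)) (by fun_prop)
      fun u => ⟨hy, trivial⟩).aestronglyMeasurable
  · refine Eventually.of_forall fun u hu x hx => hC (x, u) ⟨hx, ?_⟩
    rw [Set.uIoc_of_le zero_le_one] at hu
    exact ⟨hu.1.le, hu.2⟩
  · exact continuous_const.intervalIntegrable _ _
  · refine Eventually.of_forall fun u _ x hx => ?_
    have h1 : HasFDerivAt K (fderiv ℝ K (x, u)) (x, u) :=
      ((hK.contDiffAt (hO.mem_nhds ⟨hrV hx, trivial⟩)).differentiableAt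
        one_ne_zero).hasFDerivAt
    exact h1.comp x (hasFDerivAt_prodMk_left x u)

/-- The derivative is an integral of the same kind with values in a space of linear maps; hence the
induction is over all target spaces `F` at once. -/
theorem contDiffOn_integral_unit {V : Set Y} (hV : IsOpen V) (m : ℕ) {K : Y × ℝ → F}
    (hK : ContDiffOn ℝ m K (V ×ˢ Set.univ)) :
    ContDiffOn ℝ m (fun y => ∫ u in (0 : ℝ)..1, K (y, u)) V := by
  induction m generalizing F with
  | zero =>
    simp only [Nat.cast_zero, contDiffOn_zero] at hK ⊢
    exact continuousOn_integral_unit hK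
  | succ m ih =>
    push_cast at hK ⊢
    have hO : IsOpen (V ×ˢ (Set.univ : Set ℝ)) := hV.prod isOpen_univ
    have hd : ∀ y ∈ V, HasFDerivAt (fun y => ∫ u in (0 : ℝ)..1, K (y, u))
        (∫ u in (0 : ℝ)..1, (fderiv ℝ K (y, u)).comp (ContinuousLinearMap.inl ℝ Y ℝ)) y :=
      fun y hy => hasFDerivAt_integral_unit hV (hK.of_le (by simp)) hy
    rw [contDiffOn_succ_iff_fderiv_of_isOpen hO] at hK
    rw [contDiffOn_succ_iff_fderiv_of_isOpen hV]
    refine ⟨fun y hy => (hd y hy).differentiableAt.differentiableWithinAt, by simp, ?_⟩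
    exact (ih (hK.2.2.clm_comp contDiffOn_const)).congr fun y hy => (hd y hy).fderiv

end ParametricIntegral

theorem contDiffOn_parametric_primitive {E : Type} [NormedAddCommGroup E] [NormedSpace ℝ E]
    [ProperSpace E] {U : Set E} (hU : IsOpen U) (m : ℕ) {G : ℝ × E → ℝ}
    (hG : ContDiffOn ℝ m G (Set.univ ×ˢ U)) :
    ContDiffOn ℝ m (fun y : ℝ × E => ∫ s in (0 : ℝ)..y.1, G (s, y.2)) (Set.univ ×ˢ U) := by
  -- The substitution `s = t u` moves the variable endpoint into the integrand and leaves a fixed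
  -- interval.
  have h1 : ∀ y : ℝ × E, ∫ s in (0 : ℝ)..y.1, G (s, y.2)
      = y.1 * ∫ u in (0 : ℝ)..1, G (y.1 * u, y.2) := fun y => by
    rw [intervalIntegral.mul_integral_comp_mul_left (f := fun s => G (s, y.2))]
    simp
  simp only [h1]
  refine contDiff_fst.contDiffOn.mul ?_
  refine contDiffOn_integral_unit (Y := ℝ × E) (isOpen_univ.prod hU) m
    (K := fun z : (ℝ × E) × ℝ => G (z.1.1 * z.2, z.1.2)) ?_
  exact hG.comp (by fun_prop) fun z hz => ⟨trivial, hz.1.2⟩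

/-! ### Products over preceding indices and the Hamiltonian vector field -/

variable {n : ℕ}

/-- The product of `f i` over the indices `i` preceding `j`. -/
noncomputable def prefixProd (f : Fin n → ℝ) (j : Fin (n + 1)) : ℝ :=
  ∏ i : Fin n with i.castSucc < j, f i

@[simp] theorem prefixProd_zero (f : Fin n → ℝ) : prefixProd f 0 = 1 := by
  simp [prefixProd]

theorem prefixProd_succ (f : Fin n → ℝ) (i : Fin n) :
    prefixProd f i.succ = prefixProd f i.castSucc * f i := by
  have : (Finset.univ.filter fun k : Fin n => k.castSucc < i.succ)
      = insert i (Finset.univ.filter fun k : Fin n => k.castSucc < i.castSucc) := by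
    ext k
    simp only [Finset.mem_filter, Finset.mem_univ, true_and, Finset.mem_insert, Fin.lt_def,
      Fin.ext_iff, Fin.val_succ, Fin.val_castSucc]
    omega
  rw [prefixProd, this, Finset.prod_insert (by simp), mul_comm]
  rfl

theorem prefixProd_last (f : Fin n → ℝ) : prefixProd f (Fin.last n) = ∏ i, f i := by
  simp [prefixProd, Fin.castSucc_lt_last]

theorem prefixProd_castSucc (f : Fin n → ℝ) (j : Fin n) :
    prefixProd f j.castSucc = ∏ i : Fin n with i < j, f i := by
  simp [prefixProd]

theorem prefixProd_congr {f g : Fin n → ℝ} {j : Fin (n + 1)}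
    (h : ∀ i : Fin n, i.castSucc < j → f i = g i) : prefixProd f j = prefixProd g j :=
  Finset.prod_congr rfl fun i hi => h i (Finset.mem_filter.1 hi).2

/-- Splits off the one factor that depends on the `i`-th variable, ready for the partial derivative
in `x_i`. -/
theorem prefixProd_update (f : Fin n → ℝ) (i : Fin n) (c : ℝ) (j : Fin (n + 1)) :
    prefixProd (Function.update f i c) j
      = (if i.castSucc < j then c else 1) * prefixProd (Function.update f i 1) j := by
  unfold prefixProd
  split_ifs with h
  · have hi : i ∈ Finset.univ.filter fun k : Fin n => k.castSucc < j := by simpa using h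
    rw [Finset.prod_update_of_mem hi, Finset.prod_update_of_mem hi, one_mul]
  · have hi : i ∉ Finset.univ.filter fun k : Fin n => k.castSucc < j := by simpa using h
    rw [Finset.prod_update_of_notMem hi, Finset.prod_update_of_notMem hi, one_mul]

theorem contDiffOn_prefixProd {E : Type*} [NormedAddCommGroup E] [NormedSpace ℝ E] {s : Set E}
    {m : WithTop ℕ∞} {f : Fin n → E → ℝ} (hf : ∀ i, ContDiffOn ℝ m (f i) s) (j : Fin (n + 1)) :
    ContDiffOn ℝ m (fun y => prefixProd (fun i => f i y) j) s :=
  contDiffOn_prod fun i _ => hf i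

theorem xi_eq_prefixProd (α : Fin n → ℕ) (j : Fin (n + 1)) (x : Fin (n + 1) → ℝ) :
    xi α j x = prefixProd (fun i => x i.castSucc ^ α i) j := rfl

theorem hamiltonian_eq (α : Fin n → ℕ) (x p : Fin (n + 1) → ℝ) :
    hamiltonian α x p = (1 / 2) * ∑ j, (p j * xi α j x) ^ 2 := by
  simp [hamiltonian, vectorField]

theorem contDiff_hamiltonian (α : Fin n → ℕ) (m : WithTop ℕ∞) :
    ContDiff ℝ m fun z : (Fin (n + 1) → ℝ) × (Fin (n + 1) → ℝ) => hamiltonian α z.1 z.2 := by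
  simp only [hamiltonian_eq, xi]
  fun_prop

/-- Writes the partial derivative as a value of the full derivative of `H`, from which the vector
field inherits smoothness. -/
theorem hamiltonianVF_fst (α : Fin n → ℕ) (z : (Fin (n + 1) → ℝ) × (Fin (n + 1) → ℝ))
    (j : Fin (n + 1)) :
    (hamiltonianVF α z).1 j
      = fderiv ℝ (fun z => hamiltonian α z.1 z.2) z (0, Pi.single j 1) := by
  have h := ((contDiff_hamiltonian α 1).differentiable one_ne_zero z).hasFDerivAt
  have h2 := (HasFDerivAt.comp (f := fun q => (z.1, q)) z.2 h (hasFDerivAt_prodMk_right z.1 z.2)).fderiv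
  simp only [Function.comp_def] at h2
  simp [hamiltonianVF, h2]

theorem hamiltonianVF_snd (α : Fin n → ℕ) (z : (Fin (n + 1) → ℝ) × (Fin (n + 1) → ℝ))
    (j : Fin (n + 1)) :
    (hamiltonianVF α z).2 j
      = -fderiv ℝ (fun z => hamiltonian α z.1 z.2) z (Pi.single j 1, 0) := by
  have h := ((contDiff_hamiltonian α 1).differentiable one_ne_zero z).hasFDerivAt
  have h2 := (HasFDerivAt.comp (f := fun y => (y, z.2)) z.1 h (hasFDerivAt_prodMk_left z.1 z.2)).fderiv
  simp only [Function.comp_def] at h2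
  simp [hamiltonianVF, h2]

theorem contDiff_hamiltonianVF (α : Fin n → ℕ) (m : ℕ) : ContDiff ℝ m (hamiltonianVF α) := by
  have h : ContDiff ℝ m (fderiv ℝ fun z : (Fin (n + 1) → ℝ) × (Fin (n + 1) → ℝ) =>
      hamiltonian α z.1 z.2) :=
    (contDiff_hamiltonian α (m + 1)).fderiv_right le_rfl
  refine ContDiff.prodMk (f := fun z => (hamiltonianVF α z).1)
    (g := fun z => (hamiltonianVF α z).2) ?_ ?_
  · refine contDiff_pi.2 fun j => ?_
    simp only [hamiltonianVF_fst]
    exact h.clm_apply contDiff_const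
  · refine contDiff_pi.2 fun j => ?_
    simp only [hamiltonianVF_snd]
    exact (h.clm_apply contDiff_const).neg

theorem hamiltonianVF_fst_eq (α : Fin n → ℕ) (z : (Fin (n + 1) → ℝ) × (Fin (n + 1) → ℝ))
    (j : Fin (n + 1)) : (hamiltonianVF α z).1 j = xi α j z.1 ^ 2 * z.2 j := by
  have hd : DifferentiableAt ℝ (fun q => hamiltonian α z.1 q) z.2 :=
    ((contDiff_hamiltonian α 1).comp (contDiff_prodMk_right z.1)).differentiable one_ne_zero z.2
  change fderiv ℝ (fun q => hamiltonian α z.1 q) z.2 (Pi.single j 1) = _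
  rw [← hd.lineDeriv_eq_fderiv]
  refine HasDerivAt.deriv ?_
  simp only [hamiltonian_eq]
  have h1 : ∀ k, HasDerivAt
      (fun s : ℝ => ((z.2 + s • (Pi.single j 1 : Fin (n + 1) → ℝ)) k * xi α k z.1) ^ 2)
      (if k = j then 2 * (xi α j z.1 ^ 2 * z.2 j) else 0) 0 := by
    intro k
    have h2 : HasDerivAt (fun s : ℝ => (z.2 + s • (Pi.single j 1 : Fin (n + 1) → ℝ)) k)
        ((Pi.single j 1 : Fin (n + 1) → ℝ) k) 0 := by
      simpa using ((hasDerivAt_id (0 : ℝ)).mul_const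
        ((Pi.single j 1 : Fin (n + 1) → ℝ) k)).const_add (z.2 k)
    refine ((h2.mul_const (xi α k z.1)).pow 2).congr_deriv ?_
    by_cases hk : k = j
    · subst hk; simp; ring
    · simp [hk]
  refine ((HasDerivAt.fun_sum fun k _ => h1 k).const_mul (1 / 2)).congr_deriv ?_
  simp

theorem xi_add_single_castSucc (α : Fin n → ℕ) (j : Fin (n + 1)) (x : Fin (n + 1) → ℝ)
    (i : Fin n) (s : ℝ) :
    xi α j (x + s • Pi.single i.castSucc 1) = (if i.castSucc < j then (x i.castSucc + s) ^ α i
      else 1) * prefixProd (Function.update (fun k => x k.castSucc ^ α k) i 1) j := by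
  rw [← prefixProd_update, xi_eq_prefixProd]
  congr 1
  ext k
  by_cases hk : k = i
  · subst hk; simp
  · simp [hk, Fin.castSucc_inj]

/-- The factor `x_i^(α_i)` is removed from the products rather than divided out, because `x_i` may
vanish along the geodesic. -/
theorem hamiltonianVF_snd_castSucc (α : Fin n → ℕ)
    (z : (Fin (n + 1) → ℝ) × (Fin (n + 1) → ℝ)) (i : Fin n) :
    (hamiltonianVF α z).2 i.castSucc = -(α i * z.1 i.castSucc ^ (2 * α i - 1) *
      ∑ j with i.succ ≤ j,
        prefixProd (Function.update (fun k => z.1 k.castSucc ^ α k) i 1) j ^ 2 * z.2 j ^ 2) := by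
  have hd : DifferentiableAt ℝ (fun y => hamiltonian α y z.2) z.1 :=
    ((contDiff_hamiltonian α 1).comp (contDiff_prodMk_left z.2)).differentiable one_ne_zero z.1
  change -fderiv ℝ (fun y => hamiltonian α y z.2) z.1 (Pi.single i.castSucc 1) = _
  rw [← hd.lineDeriv_eq_fderiv]
  congr 1
  refine HasDerivAt.deriv ?_
  simp only [hamiltonian_eq, xi_add_single_castSucc]
  set W := prefixProd (Function.update (fun k => z.1 k.castSucc ^ α k) i 1) with hW
  have h1 : ∀ j, HasDerivAt
      (fun s : ℝ => (z.2 j * ((if i.castSucc < j then (z.1 i.castSucc + s) ^ α i else 1)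
        * W j)) ^ 2)
      (if i.succ ≤ j then 2 * (α i * z.1 i.castSucc ^ (2 * α i - 1)) * (W j ^ 2 * z.2 j ^ 2)
        else 0) 0 := by
    intro j
    have hiff : i.castSucc < j ↔ i.succ ≤ j := Fin.castSucc_lt_iff_succ_le
    by_cases hj : i.succ ≤ j
    · simp only [hiff, hj, if_true]
      have h2 : HasDerivAt (fun s : ℝ => (z.1 i.castSucc + s) ^ (2 * α i))
          ((2 * α i : ℕ) * z.1 i.castSucc ^ (2 * α i - 1)) 0 := by
        simpa using ((hasDerivAt_id (0 : ℝ)).const_add (z.1 i.castSucc)).fun_pow (2 * α i)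
      refine ((h2.mul_const (W j ^ 2 * z.2 j ^ 2)).congr_deriv ?_).congr_of_eventuallyEq
        (Eventually.of_forall fun s => ?_)
      · push_cast; ring
      · ring
    · simp only [hiff, hj, if_false]
      exact hasDerivAt_const _ _
  refine ((HasDerivAt.fun_sum fun k _ => h1 k).const_mul (1 / 2)).congr_deriv ?_
  rw [← Finset.sum_filter, Finset.mul_sum, Finset.mul_sum]
  exact Finset.sum_congr rfl fun j _ => by ring

theorem hamiltonianVF_snd_last (α : Fin n → ℕ) (z : (Fin (n + 1) → ℝ) × (Fin (n + 1) → ℝ)) :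
    (hamiltonianVF α z).2 (Fin.last n) = 0 := by
  have hd : DifferentiableAt ℝ (fun y => hamiltonian α y z.2) z.1 :=
    ((contDiff_hamiltonian α 1).comp (contDiff_prodMk_left z.2)).differentiable one_ne_zero z.1
  change -fderiv ℝ (fun y => hamiltonian α y z.2) z.1 (Pi.single (Fin.last n) 1) = _
  rw [← hd.lineDeriv_eq_fderiv, neg_eq_zero]
  refine HasDerivAt.deriv ?_
  have : (fun s : ℝ => hamiltonian α (z.1 + s • Pi.single (Fin.last n) 1) z.2)
      = fun _ => hamiltonian α z.1 z.2 := by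
    ext s
    simp [hamiltonian_eq, xi, Fin.castSucc_ne_last]
  rw [this]
  exact hasDerivAt_const _ _

/-! ### Uniqueness and homogeneity of extremals -/

/-- The field is only locally Lipschitz, but over a compact time interval both solutions stay in a
common ball, where it is Lipschitz. -/
theorem IsExtremalFrom.eq {α : Fin n → ℕ} {x₀ p₀ : Fin (n + 1) → ℝ}
    {z w : ℝ → (Fin (n + 1) → ℝ) × (Fin (n + 1) → ℝ)} (hz : IsExtremalFrom α x₀ p₀ z)
    (hw : IsExtremalFrom α x₀ p₀ w) : z = w := by
  ext1 t
  have hzc : Continuous z := continuous_iff_continuousAt.2 fun s => (hz.1 s).continuousAt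
  have hwc : Continuous w := continuous_iff_continuousAt.2 fun s => (hw.1 s).continuousAt
  have hcpt : IsCompact (Set.Icc (-(|t| + 1)) (|t| + 1)) := isCompact_Icc
  obtain ⟨R, hR⟩ := ((hcpt.image hzc).union (hcpt.image hwc)).isBounded.subset_closedBall 0
  obtain ⟨K, hK⟩ := (contDiff_hamiltonianVF α 1).contDiffOn.exists_lipschitzOnWith
    one_ne_zero (convex_closedBall 0 R) (isCompact_closedBall 0 R)
  have hmem : t ∈ Set.Ioo (-(|t| + 1)) (|t| + 1) :=
    ⟨by linarith [neg_abs_le t], by linarith [le_abs_self t]⟩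
  refine ODE_solution_unique_of_mem_Ioo (v := fun _ => hamiltonianVF α)
    (s := fun _ => Metric.closedBall 0 R) (t₀ := 0) (fun _ _ => hK)
    ⟨by linarith [abs_nonneg t], by linarith [abs_nonneg t]⟩
    (fun s hs => ⟨hz.1 s, hR (Or.inl ⟨s, Set.Ioo_subset_Icc_self hs, rfl⟩)⟩)
    (fun s hs => ⟨hw.1 s, hR (Or.inr ⟨s, Set.Ioo_subset_Icc_self hs, rfl⟩)⟩)
    (hz.2.trans hw.2.symm) hmem

theorem geodesic_eq {α : Fin n → ℕ} {x₀ p₀ : Fin (n + 1) → ℝ}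
    {z : ℝ → (Fin (n + 1) → ℝ) × (Fin (n + 1) → ℝ)} (hz : IsExtremalFrom α x₀ p₀ z) (t : ℝ) :
    geodesic α x₀ p₀ t = (z t).1 := by
  have h : ∃ z, IsExtremalFrom α x₀ p₀ z := ⟨z, hz⟩
  rw [geodesic, dif_pos h, h.choose_spec.eq hz]

theorem hamiltonianVF_smul (α : Fin n → ℕ) (x p : Fin (n + 1) → ℝ) (c : ℝ) :
    hamiltonianVF α (x, c • p)
      = (c • (hamiltonianVF α (x, p)).1, c ^ 2 • (hamiltonianVF α (x, p)).2) := by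
  refine Prod.ext (funext fun j => ?_) (funext fun j => ?_)
  · simp only [hamiltonianVF_fst_eq, Pi.smul_apply, smul_eq_mul]
    ring
  · induction j using Fin.lastCases with
    | last => simp [hamiltonianVF_snd_last]
    | cast i =>
      simp only [hamiltonianVF_snd_castSucc, Pi.smul_apply, smul_eq_mul, mul_pow]
      rw [mul_neg, Finset.mul_sum, Finset.mul_sum, Finset.mul_sum]
      congr 1
      exact Finset.sum_congr rfl fun j _ => by ring

theorem _root_.HasDerivAt.comp_fst {A B : Type*} [NormedAddCommGroup A] [NormedSpace ℝ A]
    [NormedAddCommGroup B] [NormedSpace ℝ B] {f : ℝ → A × B} {f' : A × B} {t : ℝ}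
    (h : HasDerivAt f f' t) : HasDerivAt (fun t => (f t).1) f'.1 t :=
  HasFDerivAt.comp_hasDerivAt (l := Prod.fst) (l' := ContinuousLinearMap.fst ℝ A B) t
    hasFDerivAt_fst h

theorem _root_.HasDerivAt.comp_snd {A B : Type*} [NormedAddCommGroup A] [NormedSpace ℝ A]
    [NormedAddCommGroup B] [NormedSpace ℝ B] {f : ℝ → A × B} {f' : A × B} {t : ℝ}
    (h : HasDerivAt f f' t) : HasDerivAt (fun t => (f t).2) f'.2 t :=
  HasFDerivAt.comp_hasDerivAt (l := Prod.snd) (l' := ContinuousLinearMap.snd ℝ A B) t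
    hasFDerivAt_snd h

/-- The velocity is linear and the force quadratic in `p`, so scaling the covector amounts to
scaling time. Consequently `exp(t p⁰)` is the geodesic of `p⁰` at time `t`. -/
theorem IsExtremalFrom.smul {α : Fin n → ℕ} {x₀ p₀ : Fin (n + 1) → ℝ}
    {z : ℝ → (Fin (n + 1) → ℝ) × (Fin (n + 1) → ℝ)} (hz : IsExtremalFrom α x₀ p₀ z) (c : ℝ) :
    IsExtremalFrom α x₀ (c • p₀) fun t => ((z (c * t)).1, c • (z (c * t)).2) := by
  refine ⟨fun t => ?_, by simp [hz.2]⟩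
  have h1 : HasDerivAt (fun t => z (c * t)) (c • hamiltonianVF α (z (c * t))) t := by
    have := (hz.1 (c * t)).scomp t ((hasDerivAt_id t).const_mul c)
    simpa [Function.comp_def] using this
  rw [hamiltonianVF_smul]
  have h2 : HasDerivAt (fun t => (z (c * t)).1) (c • (hamiltonianVF α (z (c * t))).1) t :=
    h1.comp_fst
  have h3 : HasDerivAt (fun t => (z (c * t)).2) (c • (hamiltonianVF α (z (c * t))).2) t :=
    h1.comp_snd
  refine (h2.prodMk (h3.const_smul c)).congr_deriv ?_
  rw [smul_smul, sq]

theorem expMap_smul {α : Fin n → ℕ} {x₀ p₀ : Fin (n + 1) → ℝ}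
    {z : ℝ → (Fin (n + 1) → ℝ) × (Fin (n + 1) → ℝ)} (hz : IsExtremalFrom α x₀ p₀ z) (t : ℝ) :
    expMap α x₀ (t • p₀) = (z t).1 := by
  rw [expMap, geodesic_eq (hz.smul t), mul_one]

/-! ### Riemannian points and regular angles -/

/-- If `x_i = 0` with `α_i ≠ 0`, then `ξ_{n+1}` vanishes, and every field lies in the kernel of the
last coordinate. -/
theorem IsRiemannianPoint.ne_zero {α : Fin n → ℕ} {x : Fin (n + 1) → ℝ}
    (h : IsRiemannianPoint α x) {i : Fin n} (hi : α i ≠ 0) : x i.castSucc ≠ 0 := by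
  intro h0
  have hker : Submodule.span ℝ (Set.range fun j => vectorField α j x)
      ≤ LinearMap.ker (LinearMap.proj (R := ℝ) (φ := fun _ => ℝ) (Fin.last n)) := by
    rw [Submodule.span_le]
    rintro _ ⟨j, rfl⟩
    simp only [SetLike.mem_coe, LinearMap.mem_ker, LinearMap.proj_apply, vectorField]
    by_cases hj : Fin.last n = j
    · subst hj
      rw [Pi.single_eq_same, xi]
      refine Finset.prod_eq_zero (i := i) (by simp [Fin.castSucc_lt_last]) ?_
      rw [h0, zero_pow hi]
    · exact Pi.single_eq_of_ne hj _
  have : (Pi.single (Fin.last n) 1 : Fin (n + 1) → ℝ) ∈ (⊤ : Submodule ℝ _) := trivial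
  rw [← h] at this
  simpa using hker this

theorem rho_sq {a : ℕ} (ha : a ≠ 0) (x : ℝ) : rho a x ^ 2 = x ^ (2 * a) := by
  obtain ⟨b, rfl⟩ := Nat.exists_eq_succ_of_ne_zero ha
  rw [rho, mul_pow, ← pow_mul, mul_comm _ 2, pow_mul, sq_abs]
  simp only [Nat.succ_eq_add_one, Nat.add_sub_cancel]
  ring

/-- The spherical coordinates at which no generalized sine vanishes. -/
def regularSet (α : Fin n → ℕ) : Set (Fin n → ℝ) := {φ | ∀ j, sinT (α j) (φ j) ≠ 0}

theorem contDiff_sinT (a : ℕ) (m : ℕ) : ContDiff ℝ m (sinT a) := by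
  by_cases ha : a = 0
  · subst ha
    exact Real.contDiff_sin
  · have : sinT a = genSin a := funext fun y => if_neg ha
    rw [this]
    exact (contDiff_genSin_genCos ha m).1

theorem isOpen_regularSet (α : Fin n → ℕ) : IsOpen (regularSet α) := by
  simp only [regularSet, Set.ofPred_forall]
  exact isOpen_iInter_of_finite fun j => isOpen_ne_fun
    ((contDiff_sinT (α j) 0).continuous.comp (continuous_apply j)) continuous_const

theorem genSin_ne_zero_of_regular {α : Fin n → ℕ} {φ : Fin n → ℝ} (hφ : φ ∈ regularSet α)
    {i : Fin n} (hi : α i ≠ 0) : genSin (α i) (φ i) ≠ 0 := by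
  have := hφ i
  rwa [sinT, if_neg hi] at this

/-! ### The explicit solution -/

section Solution

variable (α : Fin n → ℕ) (x₀ : Fin (n + 1) → ℝ)

/-- The `i`-th coordinate of the geodesic as a function of its own time `τ = ∫ ξ_i²`. -/
noncomputable def profile (i : Fin n) (φ : Fin n → ℝ) (τ : ℝ) : ℝ :=
  if α i = 0 then x₀ i.castSucc + Real.cos (φ i) * prefixProd (delta α x₀ φ) i.castSucc * τ
  else x₀ i.castSucc / genSin (α i) (φ i) * genSin (α i) (omega α x₀ φ i * τ + φ i)

/-- The `i`-th momentum along the geodesic as a function of the time `τ = ∫ ξ_i²`. -/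
noncomputable def momentum (i : Fin n) (φ : Fin n → ℝ) (τ : ℝ) : ℝ :=
  if α i = 0 then Real.cos (φ i) * prefixProd (delta α x₀ φ) i.castSucc
  else prefixProd (delta α x₀ φ) i.castSucc * genCos (α i) (omega α x₀ φ i * τ + φ i)

/-- `ξ_j²` along the geodesic, as a function of `(t, φ)`. -/
noncomputable def speed (j : Fin (n + 1)) : ℝ × (Fin n → ℝ) → ℝ :=
  Fin.induction (motive := fun _ => ℝ × (Fin n → ℝ) → ℝ) (fun _ => 1)
    -- The recursion is `ξ_{i+1}² = ξ_i² x_i^(2α_i)`, where `x_i` is known once `ξ_i²` has been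
    -- integrated.
    (fun i g y => g y * profile α x₀ i y.2 (∫ s in (0 : ℝ)..y.1, g (s, y.2)) ^ (2 * α i)) j

/-- The time `∫₀ᵗ ξ_j²` of the `j`-th coordinate, as a function of `(t, φ)`. -/
noncomputable def clock (j : Fin (n + 1)) (y : ℝ × (Fin n → ℝ)) : ℝ :=
  ∫ s in (0 : ℝ)..y.1, speed α x₀ j (s, y.2)

/-- The position along the geodesic, as a function of `(t, φ)`. -/
noncomputable def solPos (y : ℝ × (Fin n → ℝ)) : Fin (n + 1) → ℝ :=
  Fin.snoc (α := fun _ => ℝ) (fun i => profile α x₀ i y.2 (clock α x₀ i.castSucc y))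
    (x₀ (Fin.last n) + prefixProd (delta α x₀ y.2) (Fin.last n) * clock α x₀ (Fin.last n) y)

/-- The covector along the geodesic, as a function of `(t, φ)`. -/
noncomputable def solMom (y : ℝ × (Fin n → ℝ)) : Fin (n + 1) → ℝ :=
  Fin.snoc (α := fun _ => ℝ) (fun i => momentum α x₀ i y.2 (clock α x₀ i.castSucc y))
    (prefixProd (delta α x₀ y.2) (Fin.last n))

end Solution

variable {α : Fin n → ℕ} {x₀ : Fin (n + 1) → ℝ}

theorem omega_eq (φ : Fin n → ℝ) (i : Fin n) : omega α x₀ φ i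
    = genSin (α i) (φ i) / x₀ i.castSucc * prefixProd (delta α x₀ φ) i.castSucc := by
  rw [omega, prefixProd_castSucc]

@[simp] theorem speed_zero (y : ℝ × (Fin n → ℝ)) : speed α x₀ 0 y = 1 := rfl

theorem speed_succ (i : Fin n) (y : ℝ × (Fin n → ℝ)) : speed α x₀ i.succ y
    = speed α x₀ i.castSucc y * profile α x₀ i y.2 (clock α x₀ i.castSucc y) ^ (2 * α i) := by
  simp only [speed, Fin.induction_succ, clock]

@[simp] theorem solPos_castSucc (y : ℝ × (Fin n → ℝ)) (i : Fin n) :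
    solPos α x₀ y i.castSucc = profile α x₀ i y.2 (clock α x₀ i.castSucc y) := by
  simp [solPos]

@[simp] theorem solPos_last (y : ℝ × (Fin n → ℝ)) : solPos α x₀ y (Fin.last n)
    = x₀ (Fin.last n) + prefixProd (delta α x₀ y.2) (Fin.last n) * clock α x₀ (Fin.last n) y := by
  simp [solPos]

@[simp] theorem solMom_castSucc (y : ℝ × (Fin n → ℝ)) (i : Fin n) :
    solMom α x₀ y i.castSucc = momentum α x₀ i y.2 (clock α x₀ i.castSucc y) := by
  simp [solMom]

@[simp] theorem solMom_last (y : ℝ × (Fin n → ℝ)) :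
    solMom α x₀ y (Fin.last n) = prefixProd (delta α x₀ y.2) (Fin.last n) := by
  simp [solMom]

theorem speed_eq_xi_sq (j : Fin (n + 1)) (y : ℝ × (Fin n → ℝ)) :
    speed α x₀ j y = xi α j (solPos α x₀ y) ^ 2 := by
  induction j using Fin.induction with
  | zero => simp [xi_eq_prefixProd]
  | succ i ih =>
    rw [speed_succ, ih, xi_eq_prefixProd, xi_eq_prefixProd, prefixProd_succ, solPos_castSucc]
    ring

/-! ### Smoothness of the explicit solution in time and angles -/

theorem delta_ne_zero (hx : ∀ i : Fin n, α i ≠ 0 → x₀ i.castSucc ≠ 0) {φ : Fin n → ℝ}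
    (hφ : φ ∈ regularSet α) (i : Fin n) : delta α x₀ φ i ≠ 0 := by
  by_cases hi : α i = 0
  · have := hφ i
    rw [sinT, if_pos hi] at this
    rwa [delta, if_pos hi]
  · have h := div_ne_zero (genSin_ne_zero_of_regular hφ hi) (hx i hi)
    rw [delta, if_neg hi, rho]
    exact mul_ne_zero (pow_ne_zero _ (abs_ne_zero.2 h)) h

/-- The absolute value in `ρ` is smooth only away from zero, which is where nonvanishing of the
sines enters. -/
theorem contDiffOn_delta (hx : ∀ i : Fin n, α i ≠ 0 → x₀ i.castSucc ≠ 0) (m : ℕ) (i : Fin n) :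
    ContDiffOn ℝ m (fun φ => delta α x₀ φ i) (regularSet α) := by
  by_cases hi : α i = 0
  · simp only [delta, if_pos hi]
    exact (Real.contDiff_sin.comp (contDiff_apply ℝ ℝ i)).contDiffOn
  · simp only [delta, if_neg hi, rho]
    have hs : ContDiffOn ℝ m (fun φ : Fin n → ℝ => genSin (α i) (φ i) / x₀ i.castSucc)
        (regularSet α) :=
      (((contDiff_genSin_genCos hi m).1.comp (contDiff_apply ℝ ℝ i)).div_const _).contDiffOn
    refine (ContDiffOn.pow (hs.abs fun φ hφ => ?_) _).mul hs
    exact div_ne_zero (genSin_ne_zero_of_regular hφ hi) (hx i hi)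

theorem contDiffOn_prefixProd_delta (hx : ∀ i : Fin n, α i ≠ 0 → x₀ i.castSucc ≠ 0) (m : ℕ)
    (j : Fin (n + 1)) : ContDiffOn ℝ m (fun y : ℝ × (Fin n → ℝ) => prefixProd (delta α x₀ y.2) j)
      (Set.univ ×ˢ regularSet α) :=
  (contDiffOn_prefixProd (contDiffOn_delta hx m) j).comp contDiff_snd.contDiffOn fun _ hy => hy.2

theorem contDiffOn_phase (hx : ∀ i : Fin n, α i ≠ 0 → x₀ i.castSucc ≠ 0) (m : ℕ)
    {i : Fin n} (hi : α i ≠ 0) {τ : ℝ × (Fin n → ℝ) → ℝ}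
    (hτ : ContDiffOn ℝ m τ (Set.univ ×ˢ regularSet α)) :
    ContDiffOn ℝ m (fun y => omega α x₀ y.2 i * τ y + y.2 i) (Set.univ ×ˢ regularSet α) := by
  simp only [omega_eq]
  refine ContDiffOn.add (ContDiffOn.mul (ContDiffOn.mul (ContDiffOn.div_const ?_ _)
    (contDiffOn_prefixProd_delta hx m _)) hτ) (ContDiff.contDiffOn (by fun_prop))
  exact ((contDiff_genSin_genCos hi m).1.comp
    (show ContDiff ℝ m fun y : ℝ × (Fin n → ℝ) => y.2 i by fun_prop)).contDiffOn

theorem contDiffOn_profile (hx : ∀ i : Fin n, α i ≠ 0 → x₀ i.castSucc ≠ 0) (m : ℕ)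
    (i : Fin n) {τ : ℝ × (Fin n → ℝ) → ℝ}
    (hτ : ContDiffOn ℝ m τ (Set.univ ×ˢ regularSet α)) :
    ContDiffOn ℝ m (fun y => profile α x₀ i y.2 (τ y)) (Set.univ ×ˢ regularSet α) := by
  by_cases hi : α i = 0
  · simp only [profile, if_pos hi]
    refine contDiffOn_const.add (((ContDiff.contDiffOn (by fun_prop)).mul
      (contDiffOn_prefixProd_delta hx m _)).mul hτ)
  · simp only [profile, if_neg hi]
    refine ContDiffOn.mul (contDiffOn_const.div ?_ fun y hy => genSin_ne_zero_of_regular hy.2 hi)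
      ((contDiff_genSin_genCos hi m).1.comp_contDiffOn (contDiffOn_phase hx m hi hτ))
    exact ((contDiff_genSin_genCos hi m).1.comp
      (show ContDiff ℝ m fun y : ℝ × (Fin n → ℝ) => y.2 i by fun_prop)).contDiffOn

theorem contDiffOn_momentum (hx : ∀ i : Fin n, α i ≠ 0 → x₀ i.castSucc ≠ 0) (m : ℕ)
    (i : Fin n) {τ : ℝ × (Fin n → ℝ) → ℝ}
    (hτ : ContDiffOn ℝ m τ (Set.univ ×ˢ regularSet α)) :
    ContDiffOn ℝ m (fun y => momentum α x₀ i y.2 (τ y)) (Set.univ ×ˢ regularSet α) := by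
  by_cases hi : α i = 0
  · simp only [momentum, if_pos hi]
    exact (ContDiff.contDiffOn (by fun_prop)).mul (contDiffOn_prefixProd_delta hx m _)
  · simp only [momentum, if_neg hi]
    exact (contDiffOn_prefixProd_delta hx m _).mul
      ((contDiff_genSin_genCos hi m).2.comp_contDiffOn (contDiffOn_phase hx m hi hτ))

theorem contDiffOn_speed (hx : ∀ i : Fin n, α i ≠ 0 → x₀ i.castSucc ≠ 0) (m : ℕ)
    (j : Fin (n + 1)) : ContDiffOn ℝ m (speed α x₀ j) (Set.univ ×ˢ regularSet α) := by
  induction j using Fin.induction with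
  | zero => exact contDiffOn_const
  | succ i ih =>
    have : speed α x₀ i.succ = fun y => speed α x₀ i.castSucc y
        * profile α x₀ i y.2 (clock α x₀ i.castSucc y) ^ (2 * α i) := funext (speed_succ i)
    rw [this]
    exact ih.mul ((contDiffOn_profile hx m i
      (contDiffOn_parametric_primitive (isOpen_regularSet α) m ih)).pow _)

theorem contDiffOn_clock (hx : ∀ i : Fin n, α i ≠ 0 → x₀ i.castSucc ≠ 0) (m : ℕ)
    (j : Fin (n + 1)) : ContDiffOn ℝ m (clock α x₀ j) (Set.univ ×ˢ regularSet α) :=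
  contDiffOn_parametric_primitive (isOpen_regularSet α) m (contDiffOn_speed hx m j)

theorem contDiffOn_solPos (hx : ∀ i : Fin n, α i ≠ 0 → x₀ i.castSucc ≠ 0) (m : ℕ) :
    ContDiffOn ℝ m (solPos α x₀) (Set.univ ×ˢ regularSet α) := by
  refine contDiffOn_pi.2 fun j => ?_
  induction j using Fin.lastCases with
  | last =>
    simp only [solPos_last]
    exact contDiffOn_const.add ((contDiffOn_prefixProd_delta hx m _).mul (contDiffOn_clock hx m _))
  | cast i =>
    simp only [solPos_castSucc]
    exact contDiffOn_profile hx m i (contDiffOn_clock hx m _)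

theorem contDiffOn_solMom (hx : ∀ i : Fin n, α i ≠ 0 → x₀ i.castSucc ≠ 0) (m : ℕ) :
    ContDiffOn ℝ m (solMom α x₀) (Set.univ ×ˢ regularSet α) := by
  refine contDiffOn_pi.2 fun j => ?_
  induction j using Fin.lastCases with
  | last =>
    simp only [solMom_last]
    exact contDiffOn_prefixProd_delta hx m _
  | cast i =>
    simp only [solMom_castSucc]
    exact contDiffOn_momentum hx m i (contDiffOn_clock hx m _)

/-! ### Hamilton's equations for the explicit solution -/

theorem hasDerivAt_clock (hx : ∀ i : Fin n, α i ≠ 0 → x₀ i.castSucc ≠ 0) {φ : Fin n → ℝ}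
    (hφ : φ ∈ regularSet α) (j : Fin (n + 1)) (t : ℝ) :
    HasDerivAt (fun t => clock α x₀ j (t, φ)) (speed α x₀ j (t, φ)) t := by
  have hc : Continuous fun s => speed α x₀ j (s, φ) :=
    (contDiffOn_speed hx 0 j).continuousOn.comp_continuous (by fun_prop) fun s => ⟨trivial, hφ⟩
  exact intervalIntegral.integral_hasDerivAt_right (hc.intervalIntegrable _ _)
    (hc.stronglyMeasurableAtFilter _ _) hc.continuousAt

theorem hasDerivAt_phase (φ : Fin n → ℝ) (i : Fin n) (τ : ℝ) :
    HasDerivAt (fun τ => omega α x₀ φ i * τ + φ i) (omega α x₀ φ i) τ := by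
  simpa using ((hasDerivAt_id τ).const_mul (omega α x₀ φ i)).add_const (φ i)

/-- For `α_i ≠ 0` the amplitude times the frequency is `(x⁰_i / sin φ_i) ω_i = P_i`, exactly the
amplitude of the momentum. -/
theorem hasDerivAt_profile (hx : ∀ i : Fin n, α i ≠ 0 → x₀ i.castSucc ≠ 0) {φ : Fin n → ℝ}
    (hφ : φ ∈ regularSet α) (i : Fin n) (τ : ℝ) :
    HasDerivAt (profile α x₀ i φ) (momentum α x₀ i φ τ) τ := by
  by_cases hi : α i = 0
  · have : profile α x₀ i φ = fun τ => x₀ i.castSucc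
        + Real.cos (φ i) * prefixProd (delta α x₀ φ) i.castSucc * τ := by
      ext τ; rw [profile, if_pos hi]
    rw [this, momentum, if_pos hi]
    simpa using ((hasDerivAt_id τ).const_mul
      (Real.cos (φ i) * prefixProd (delta α x₀ φ) i.castSucc)).const_add (x₀ i.castSucc)
  · have : profile α x₀ i φ = fun τ => x₀ i.castSucc / genSin (α i) (φ i)
        * genSin (α i) (omega α x₀ φ i * τ + φ i) := by
      ext τ; rw [profile, if_neg hi]
    rw [this, momentum, if_neg hi]
    have h := ((hasDerivAt_genSin hi _).comp τ (hasDerivAt_phase (α := α) (x₀ := x₀) φ i τ)).const_mul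
      (x₀ i.castSucc / genSin (α i) (φ i))
    refine h.congr_deriv ?_
    have h1 := genSin_ne_zero_of_regular hφ hi
    have h2 := hx i hi
    rw [omega_eq]
    field_simp

theorem delta_sq {φ : Fin n → ℝ} {i : Fin n} (hi : α i ≠ 0) :
    delta α x₀ φ i ^ 2 = (genSin (α i) (φ i) / x₀ i.castSucc) ^ (2 * α i) := by
  rw [delta, if_neg hi, rho_sq hi]

theorem hasDerivAt_momentum (hx : ∀ i : Fin n, α i ≠ 0 → x₀ i.castSucc ≠ 0) {φ : Fin n → ℝ}
    (hφ : φ ∈ regularSet α) (i : Fin n) (τ : ℝ) :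
    HasDerivAt (momentum α x₀ i φ) (-(α i * profile α x₀ i φ τ ^ (2 * α i - 1)
      * prefixProd (delta α x₀ φ) i.succ ^ 2)) τ := by
  by_cases hi : α i = 0
  · have : momentum α x₀ i φ = fun τ =>
        Real.cos (φ i) * prefixProd (delta α x₀ φ) i.castSucc := by
      ext τ; rw [momentum, if_pos hi]
    rw [this, hi]
    simpa using hasDerivAt_const τ (Real.cos (φ i) * prefixProd (delta α x₀ φ) i.castSucc)
  · have : momentum α x₀ i φ = fun τ => prefixProd (delta α x₀ φ) i.castSucc
        * genCos (α i) (omega α x₀ φ i * τ + φ i) := by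
      ext τ; rw [momentum, if_neg hi]
    rw [this, profile, if_neg hi]
    have h := ((hasDerivAt_genCos hi _).comp τ (hasDerivAt_phase (α := α) (x₀ := x₀) φ i τ)).const_mul
      (prefixProd (delta α x₀ φ) i.castSucc)
    refine h.congr_deriv ?_
    have h1 := genSin_ne_zero_of_regular hφ hi
    have h2 := hx i hi
    generalize genSin (α i) (omega α x₀ φ i * τ + φ i) = S
    rw [prefixProd_succ, mul_pow _ (delta α x₀ φ i), delta_sq hi, omega_eq, mul_pow]
    obtain ⟨b, hb⟩ := Nat.exists_eq_succ_of_ne_zero hi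
    have e1 : 2 * α i - 1 = 2 * b + 1 := by omega
    have e2 : 2 * α i = 2 * b + 1 + 1 := by omega
    rw [e1, e2]
    -- The `2α_i - 1` powers of the amplitude in the profile cancel all but one of the `2α_i`
    -- factors in `δ_i²`; the remaining one belongs to `ω_i`.
    have h3 : (x₀ i.castSucc / genSin (α i) (φ i)) ^ (2 * b + 1)
        * (genSin (α i) (φ i) / x₀ i.castSucc) ^ (2 * b + 1) = 1 := by
      rw [← mul_pow, div_mul_div_cancel₀ h1, div_self h2, one_pow]
    rw [pow_succ (genSin (α i) (φ i) / x₀ i.castSucc)]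
    linear_combination α i * S ^ (2 * b + 1) * prefixProd (delta α x₀ φ) i.castSucc ^ 2
      * (genSin (α i) (φ i) / x₀ i.castSucc) * h3

/-- The (generalized) Pythagorean identity scaled by `P_i²`: a first integral of the `i`-th
coordinate in its own time. -/
theorem momentum_sq_add (hx : ∀ i : Fin n, α i ≠ 0 → x₀ i.castSucc ≠ 0) {φ : Fin n → ℝ}
    (hφ : φ ∈ regularSet α) (i : Fin n) (τ : ℝ) :
    momentum α x₀ i φ τ ^ 2
      + profile α x₀ i φ τ ^ (2 * α i) * prefixProd (delta α x₀ φ) i.succ ^ 2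
      = prefixProd (delta α x₀ φ) i.castSucc ^ 2 := by
  rw [prefixProd_succ, mul_pow _ (delta α x₀ φ i)]
  by_cases hi : α i = 0
  · rw [momentum, if_pos hi, delta, if_pos hi, hi, mul_zero, pow_zero, Real.sin_sq]
    ring
  · rw [delta_sq hi, momentum, if_neg hi, profile, if_neg hi]
    have h1 := genSin_ne_zero_of_regular hφ hi
    have h2 := hx i hi
    have h3 := genCos_sq_add_genSin_pow hi (omega α x₀ φ i * τ + φ i)
    set s := genSin (α i) (omega α x₀ φ i * τ + φ i)
    have h4 : (x₀ i.castSucc / genSin (α i) (φ i) * s) ^ (2 * α i)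
        * (genSin (α i) (φ i) / x₀ i.castSucc) ^ (2 * α i) = s ^ (2 * α i) := by
      rw [← mul_pow]
      congr 1
      field_simp
    linear_combination prefixProd (delta α x₀ φ) i.castSucc ^ 2 * (h3 + h4)

/-- The sum collapses from the last index downwards, each first integral absorbing one more term.
The weights are constrained only from `m` on. This covers both `ξ_j²` starting at the first index,
giving `H`, and the products without their `i`-th factor starting at `i + 1`, giving the force on
`p_i`. -/
theorem sum_weighted_sq {p P W : Fin (n + 1) → ℝ} {y : Fin n → ℝ}
    (hp : ∀ i : Fin n, p i.castSucc ^ 2 + y i * P i.succ ^ 2 = P i.castSucc ^ 2)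
    (hlast : p (Fin.last n) ^ 2 = P (Fin.last n) ^ 2) (m : Fin (n + 1))
    (hW : ∀ i : Fin n, m ≤ i.castSucc → W i.succ = W i.castSucc * y i) :
    ∑ j with m ≤ j, W j * p j ^ 2 = W m * P m ^ 2 := by
  induction m using Fin.reverseInduction with
  | last =>
    have : (Finset.univ.filter fun j : Fin (n + 1) => Fin.last n ≤ j) = {Fin.last n} := by
      ext j; simp [Fin.last_le_iff]
    rw [this, Finset.sum_singleton, hlast]
  | cast i ih =>
    have : (Finset.univ.filter fun j : Fin (n + 1) => i.castSucc ≤ j)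
        = insert i.castSucc (Finset.univ.filter fun j : Fin (n + 1) => i.succ ≤ j) := by
      ext j
      simp only [Finset.mem_filter, Finset.mem_univ, true_and, Finset.mem_insert, Fin.le_def,
        Fin.ext_iff, Fin.val_succ, Fin.val_castSucc]
      omega
    rw [this, Finset.sum_insert (by simp), ih fun k hk => hW k
      ((Fin.castSucc_lt_succ).le.trans hk), hW i le_rfl, ← hp i]
    ring

theorem energy_sum (hx : ∀ i : Fin n, α i ≠ 0 → x₀ i.castSucc ≠ 0) {y : ℝ × (Fin n → ℝ)}
    (hφ : y.2 ∈ regularSet α) {W : Fin (n + 1) → ℝ} (m : Fin (n + 1))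
    (hW : ∀ i : Fin n, m ≤ i.castSucc →
      W i.succ = W i.castSucc * solPos α x₀ y i.castSucc ^ (2 * α i)) :
    ∑ j with m ≤ j, W j * solMom α x₀ y j ^ 2 = W m * prefixProd (delta α x₀ y.2) m ^ 2 := by
  refine sum_weighted_sq (fun i => ?_) (by rw [solMom_last]) m hW
  rw [solMom_castSucc, solPos_castSucc]
  exact momentum_sq_add hx hφ i _

theorem hamiltonian_sol (hx : ∀ i : Fin n, α i ≠ 0 → x₀ i.castSucc ≠ 0)
    {y : ℝ × (Fin n → ℝ)} (hφ : y.2 ∈ regularSet α) :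
    hamiltonian α (solPos α x₀ y) (solMom α x₀ y) = 1 / 2 := by
  have h := energy_sum hx hφ (W := fun j => speed α x₀ j y) 0 fun i _ => by
    rw [speed_succ, solPos_castSucc]
  simp only [Fin.zero_le, Finset.filter_true, speed_zero, prefixProd_zero] at h
  rw [hamiltonian_eq, Finset.sum_congr rfl fun j _ => mul_pow _ _ 2]
  simp only [speed_eq_xi_sq] at h
  simp only [mul_comm (solMom α x₀ y _ ^ 2), h]
  norm_num

theorem isExtremalFrom_sol (hx : ∀ i : Fin n, α i ≠ 0 → x₀ i.castSucc ≠ 0) {φ : Fin n → ℝ}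
    (hφ : φ ∈ regularSet α) : IsExtremalFrom α x₀ (covector α x₀ φ)
      fun t => (solPos α x₀ (t, φ), solMom α x₀ (t, φ)) := by
  constructor
  · intro t
    refine (HasDerivAt.prodMk (hasDerivAt_pi.2 fun j => ?_ :
      HasDerivAt (fun t => solPos α x₀ (t, φ)) (hamiltonianVF α _).1 t)
      (hasDerivAt_pi.2 fun j => ?_ :
        HasDerivAt (fun t => solMom α x₀ (t, φ)) (hamiltonianVF α _).2 t))
    · rw [hamiltonianVF_fst_eq, ← speed_eq_xi_sq]
      induction j using Fin.lastCases with
      | last =>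
        simp only [solPos_last, solMom_last]
        refine (((hasDerivAt_clock hx hφ _ t).const_mul _).const_add _).congr_deriv ?_
        ring
      | cast i =>
        simp only [solPos_castSucc, solMom_castSucc]
        refine ((hasDerivAt_profile hx hφ i _).comp t (hasDerivAt_clock hx hφ _ t)).congr_deriv ?_
        ring
    · induction j using Fin.lastCases with
      | last =>
        rw [hamiltonianVF_snd_last]
        simp only [solMom_last]
        exact hasDerivAt_const _ _
      | cast i =>
        rw [hamiltonianVF_snd_castSucc]
        simp only [solMom_castSucc]
        refine ((hasDerivAt_momentum hx hφ i _).comp t (hasDerivAt_clock hx hφ _ t)).congr_deriv ?_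
        set f : Fin n → ℝ := fun k => solPos α x₀ (t, φ) k.castSucc ^ α k with hf
        -- At the first index after `i`, removing the `i`-th factor leaves exactly `ξ_i`, whose
        -- square is the rate of the `i`-th clock.
        have hW : prefixProd (Function.update f i 1) i.succ = prefixProd f i.castSucc := by
          rw [prefixProd_succ, Function.update_self, mul_one]
          refine prefixProd_congr fun k hk => Function.update_of_ne ?_ _ _
          rintro rfl
          exact lt_irrefl _ hk
        rw [energy_sum hx (y := (t, φ)) hφ
          (W := fun j => prefixProd (Function.update f i 1) j ^ 2) i.succ, hW, speed_eq_xi_sq,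
          xi_eq_prefixProd, solPos_castSucc]
        · ring
        · intro k hk
          rw [prefixProd_succ, Function.update_of_ne, hf]
          · ring
          · rintro rfl
            exact absurd hk (not_le.2 Fin.castSucc_lt_succ)
  · have hc : ∀ j, clock α x₀ j (0, φ) = 0 := fun j => by simp [clock]
    refine Prod.ext (funext fun j => ?_) (funext fun j => ?_)
    · induction j using Fin.lastCases with
      | last => simp [hc]
      | cast i =>
        simp only [solPos_castSucc, hc, profile]
        split_ifs with hi
        · simp
        · have h1 := genSin_ne_zero_of_regular hφ hi
          simp [h1]
    · induction j using Fin.lastCases with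
      | last => simp [covector, prefixProd_last]
      | cast i =>
        simp only [solMom_castSucc, hc, momentum, covector, Fin.snoc_castSucc, cosT,
          prefixProd_castSucc]
        split_ifs with hi
        · rfl
        · simp [mul_comm]

/-! ### The covector annihilates the variations of the geodesic -/

theorem differentiableAt_solPos (hx : ∀ i : Fin n, α i ≠ 0 → x₀ i.castSucc ≠ 0)
    {y : ℝ × (Fin n → ℝ)} (hy : y.2 ∈ regularSet α) : DifferentiableAt ℝ (solPos α x₀) y :=
  ((contDiffOn_solPos hx 1).contDiffAt ((isOpen_univ.prod (isOpen_regularSet α)).mem_nhds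
    ⟨trivial, hy⟩)).differentiableAt one_ne_zero

theorem differentiableAt_solMom (hx : ∀ i : Fin n, α i ≠ 0 → x₀ i.castSucc ≠ 0)
    {y : ℝ × (Fin n → ℝ)} (hy : y.2 ∈ regularSet α) : DifferentiableAt ℝ (solMom α x₀) y :=
  ((contDiffOn_solMom hx 1).contDiffAt ((isOpen_univ.prod (isOpen_regularSet α)).mem_nhds
    ⟨trivial, hy⟩)).differentiableAt one_ne_zero

theorem eventually_regular {y : ℝ × (Fin n → ℝ)} (hy : y.2 ∈ regularSet α) :
    ∀ᶠ z : ℝ × (Fin n → ℝ) in 𝓝 y, z.2 ∈ regularSet α :=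
  continuous_snd.continuousAt.eventually ((isOpen_regularSet α).mem_nhds hy)

theorem hasDerivAt_prodMk_left {E : Type*} [NormedAddCommGroup E] [NormedSpace ℝ E] (t : ℝ)
    (φ : E) : HasDerivAt (fun s : ℝ => (s, φ)) (1, 0) t :=
  (hasDerivAt_id t).prodMk (hasDerivAt_const t φ)

theorem hasDerivAt_comp_time {E F : Type*} [NormedAddCommGroup E] [NormedSpace ℝ E]
    [NormedAddCommGroup F] [NormedSpace ℝ F] {f : ℝ × E → F} {y : ℝ × E}
    (hf : DifferentiableAt ℝ f y) : HasDerivAt (fun s : ℝ => f (s, y.2)) (fderiv ℝ f y (1, 0)) y.1 :=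
  hf.hasFDerivAt.comp_hasDerivAt (f := fun s : ℝ => (s, y.2)) y.1 (hasDerivAt_prodMk_left y.1 y.2)

theorem fderiv_solPos_time (hx : ∀ i : Fin n, α i ≠ 0 → x₀ i.castSucc ≠ 0)
    {y : ℝ × (Fin n → ℝ)} (hy : y.2 ∈ regularSet α) :
    fderiv ℝ (solPos α x₀) y (1, 0) = (hamiltonianVF α (solPos α x₀ y, solMom α x₀ y)).1 := by
  exact (hasDerivAt_comp_time (differentiableAt_solPos hx hy)).unique ((isExtremalFrom_sol hx hy).1 y.1).comp_fst

theorem dotProduct_hamiltonianVF_fst (x p : Fin (n + 1) → ℝ) :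
    p ⬝ᵥ (hamiltonianVF α (x, p)).1 = 2 * hamiltonian α x p := by
  rw [hamiltonian_eq, dotProduct, Finset.mul_sum, Finset.mul_sum]
  refine Finset.sum_congr rfl fun j _ => ?_
  rw [hamiltonianVF_fst_eq]
  ring

theorem fderiv_hamiltonian_apply (x p u v : Fin (n + 1) → ℝ) :
    fderiv ℝ (fun z : (Fin (n + 1) → ℝ) × (Fin (n + 1) → ℝ) => hamiltonian α z.1 z.2) (x, p) (u, v)
      = v ⬝ᵥ (hamiltonianVF α (x, p)).1 - u ⬝ᵥ (hamiltonianVF α (x, p)).2 := by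
  set L := fderiv ℝ (fun z : (Fin (n + 1) → ℝ) × (Fin (n + 1) → ℝ) => hamiltonian α z.1 z.2) (x, p)
    with hL
  have hsingle : ∀ i : Fin (n + 1), (fun j => if i = j then (1 : ℝ) else 0) = Pi.single i 1 :=
    fun i => by ext j; simp [Pi.single_apply, eq_comm]
  have h1 : ∀ u, L (u, 0) = ∑ j, u j * L (Pi.single j 1, 0) := fun u => by
    simpa [hsingle] using (L.comp (ContinuousLinearMap.inl ℝ _ _)).toLinearMap.pi_apply_eq_sum_univ u
  have h2 : ∀ v, L (0, v) = ∑ j, v j * L (0, Pi.single j 1) := fun v => by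
    simpa [hsingle] using (L.comp (ContinuousLinearMap.inr ℝ _ _)).toLinearMap.pi_apply_eq_sum_univ v
  have h3 : (u, v) = (u, 0) + (0, v) := by simp
  rw [h3, map_add, h1, h2, add_comm, sub_eq_add_neg]
  congr 1
  · refine Finset.sum_congr rfl fun j _ => ?_
    rw [hamiltonianVF_fst]
  · rw [dotProduct, ← Finset.sum_neg_distrib]
    refine Finset.sum_congr rfl fun j _ => ?_
    rw [hamiltonianVF_snd]
    ring

/-- Euler's identity for `H`, quadratic in `p`: `⟨p, ∂H/∂p⟩ = 2H`, on the energy level `1/2`. -/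
theorem solMom_dotProduct_velocity (hx : ∀ i : Fin n, α i ≠ 0 → x₀ i.castSucc ≠ 0)
    {y : ℝ × (Fin n → ℝ)} (hy : y.2 ∈ regularSet α) :
    solMom α x₀ y ⬝ᵥ fderiv ℝ (solPos α x₀) y (1, 0) = 1 := by
  rw [fderiv_solPos_time hx hy, dotProduct_hamiltonianVF_fst, hamiltonian_sol hx hy]
  norm_num

theorem _root_.HasDerivAt.dotProduct {m : ℕ} {u v : ℝ → Fin m → ℝ} {u' v' : Fin m → ℝ} {t : ℝ}
    (hu : HasDerivAt u u' t) (hv : HasDerivAt v v' t) :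
    HasDerivAt (fun t => u t ⬝ᵥ v t) (u' ⬝ᵥ v t + u t ⬝ᵥ v') t := by
  have := HasDerivAt.fun_sum (u := Finset.univ) fun j _ =>
    (hasDerivAt_pi.1 hu j).fun_mul (hasDerivAt_pi.1 hv j)
  rwa [Finset.sum_add_distrib] at this

theorem hasDerivAt_line {E : Type*} [NormedAddCommGroup E] [NormedSpace ℝ E] (y w : E) :
    HasDerivAt (fun r : ℝ => y + r • w) w 0 := by
  simpa using ((hasDerivAt_id (0 : ℝ)).smul_const w).const_add y

theorem _root_.DifferentiableAt.hasDerivAt_comp_line {E F : Type*} [NormedAddCommGroup E]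
    [NormedSpace ℝ E] [NormedAddCommGroup F] [NormedSpace ℝ F] {f : E → F} {y : E}
    (hf : DifferentiableAt ℝ f y) (w : E) :
    HasDerivAt (fun r : ℝ => f (y + r • w)) (fderiv ℝ f y w) 0 :=
  hf.hasFDerivAt.comp_hasDerivAt_of_eq (0 : ℝ) (hasDerivAt_line y w) (by simp)

theorem eventually_regular_line {y : ℝ × (Fin n → ℝ)} (hy : y.2 ∈ regularSet α)
    (w : ℝ × (Fin n → ℝ)) : ∀ᶠ r : ℝ in 𝓝 0, (y + r • w).2 ∈ regularSet α := by
  have h : Tendsto (fun r : ℝ => y + r • w) (𝓝 0) (𝓝 y) := by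
    simpa using (hasDerivAt_line y w).continuousAt.tendsto
  exact h.eventually (eventually_regular hy)

theorem _root_.HasDerivAt.clm_apply_const {E F : Type*} [NormedAddCommGroup E]
    [NormedSpace ℝ E] [NormedAddCommGroup F] [NormedSpace ℝ F] {c : ℝ → E →L[ℝ] F}
    {c' : E →L[ℝ] F} {t : ℝ} (h : HasDerivAt c c' t) (w : E) :
    HasDerivAt (fun s => c s w) (c' w) t := by
  simpa using h.clm_apply (hasDerivAt_const t w)

theorem differentiableAt_fderiv_solPos (hx : ∀ i : Fin n, α i ≠ 0 → x₀ i.castSucc ≠ 0)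
    {y : ℝ × (Fin n → ℝ)} (hy : y.2 ∈ regularSet α) :
    DifferentiableAt ℝ (fderiv ℝ (solPos α x₀)) y := by
  have hc2 : ContDiffAt ℝ 2 (solPos α x₀) y := (contDiffOn_solPos hx 2).contDiffAt
    ((isOpen_univ.prod (isOpen_regularSet α)).mem_nhds ⟨trivial, hy⟩)
  exact (hc2.fderiv_right (m := 1) (by norm_num)).differentiableAt one_ne_zero

theorem fderiv_fderiv_solPos_symm (hx : ∀ i : Fin n, α i ≠ 0 → x₀ i.castSucc ≠ 0)
    {y : ℝ × (Fin n → ℝ)} (hy : y.2 ∈ regularSet α) (v w : ℝ × (Fin n → ℝ)) :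
    fderiv ℝ (fderiv ℝ (solPos α x₀)) y v w = fderiv ℝ (fderiv ℝ (solPos α x₀)) y w v := by
  have hc2 : ContDiffAt ℝ 2 (solPos α x₀) y := (contDiffOn_solPos hx 2).contDiffAt
    ((isOpen_univ.prod (isOpen_regularSet α)).mem_nhds ⟨trivial, hy⟩)
  exact hc2.isSymmSndFDerivAt (by simp) _ _

/-- The derivative of `⟨p, x'⟩ = 1` in an arbitrary direction. -/
theorem fderiv_euler (hx : ∀ i : Fin n, α i ≠ 0 → x₀ i.castSucc ≠ 0)
    {y : ℝ × (Fin n → ℝ)} (hy : y.2 ∈ regularSet α) (w : ℝ × (Fin n → ℝ)) :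
    fderiv ℝ (solMom α x₀) y w ⬝ᵥ fderiv ℝ (solPos α x₀) y (1, 0)
      + solMom α x₀ y ⬝ᵥ fderiv ℝ (fderiv ℝ (solPos α x₀)) y w (1, 0) = 0 := by
  have hA : HasDerivAt (fun r : ℝ => fderiv ℝ (solPos α x₀) (y + r • w) (1, 0))
      (fderiv ℝ (fderiv ℝ (solPos α x₀)) y w (1, 0)) 0 :=
    ((differentiableAt_fderiv_solPos hx hy).hasDerivAt_comp_line w).clm_apply_const (1, 0)
  have h := ((differentiableAt_solMom hx hy).hasDerivAt_comp_line w).dotProduct hA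
  simp only [zero_smul, add_zero] at h
  refine h.unique ((hasDerivAt_const (0 : ℝ) (1 : ℝ)).congr_of_eventuallyEq ?_)
  filter_upwards [eventually_regular_line hy w] with r hr
  exact solMom_dotProduct_velocity hx hr

/-- The derivative of `H = 1 / 2` in an arbitrary direction. -/
theorem fderiv_energy (hx : ∀ i : Fin n, α i ≠ 0 → x₀ i.castSucc ≠ 0)
    {y : ℝ × (Fin n → ℝ)} (hy : y.2 ∈ regularSet α) (w : ℝ × (Fin n → ℝ)) :
    fderiv ℝ (solMom α x₀) y w ⬝ᵥ (hamiltonianVF α (solPos α x₀ y, solMom α x₀ y)).1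
      - fderiv ℝ (solPos α x₀) y w ⬝ᵥ (hamiltonianVF α (solPos α x₀ y, solMom α x₀ y)).2
      = 0 := by
  rw [← fderiv_hamiltonian_apply]
  have h := HasFDerivAt.comp_hasDerivAt_of_eq (0 : ℝ)
    ((contDiff_hamiltonian α 1).differentiable one_ne_zero
      (solPos α x₀ y, solMom α x₀ y)).hasFDerivAt
    (((differentiableAt_solPos hx hy).hasDerivAt_comp_line w).prodMk
      ((differentiableAt_solMom hx hy).hasDerivAt_comp_line w)) (by simp)
  refine h.unique ((hasDerivAt_const (0 : ℝ) (1 / 2 : ℝ)).congr_of_eventuallyEq ?_)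
  filter_upwards [eventually_regular_line hy w] with r hr
  exact hamiltonian_sol hx hr

/-- The algebra behind constancy of `⟨p, ∂x⟩`. Here `q = ∂p`, `u = ∂x`, `(v₁, v₂)` is the
Hamiltonian field, and `d`, `d'` are the two orders of the mixed second derivative. The variations
of `⟨p, x'⟩ = 1` and of `H = 1/2` share the term `⟨∂p, x'⟩`, which their difference removes. -/
theorem dotProduct_add_eq_zero {m : ℕ} {p v₁ v₂ u q d d' x' : Fin m → ℝ}
    (h₁ : q ⬝ᵥ x' + p ⬝ᵥ d' = 0) (h₂ : q ⬝ᵥ v₁ - u ⬝ᵥ v₂ = 0) (hx' : x' = v₁) (hd : d = d') :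
    v₂ ⬝ᵥ u + p ⬝ᵥ d = 0 := by
  subst hx' hd
  rw [dotProduct_comm]
  linear_combination h₁ - h₂

/-- The pairing of the covector with a variation of the geodesic is constant in time. -/
theorem hasDerivAt_solMom_dotProduct (hx : ∀ i : Fin n, α i ≠ 0 → x₀ i.castSucc ≠ 0)
    {φ : Fin n → ℝ} (hφ : φ ∈ regularSet α) (w : ℝ × (Fin n → ℝ)) (t : ℝ) :
    HasDerivAt (fun t => solMom α x₀ (t, φ) ⬝ᵥ fderiv ℝ (solPos α x₀) (t, φ) w) 0 t := by
  have hM : HasDerivAt (fun s => solMom α x₀ (s, φ))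
      (hamiltonianVF α (solPos α x₀ (t, φ), solMom α x₀ (t, φ))).2 t :=
    ((isExtremalFrom_sol hx hφ).1 t).comp_snd
  have hD : HasDerivAt (fun s => fderiv ℝ (solPos α x₀) (s, φ) w)
      (fderiv ℝ (fderiv ℝ (solPos α x₀)) (t, φ) (1, 0) w) t :=
    (hasDerivAt_comp_time (differentiableAt_fderiv_solPos hx (y := (t, φ)) hφ)).clm_apply_const w
  refine (hM.dotProduct hD).congr_deriv ?_
  exact dotProduct_add_eq_zero (fderiv_euler hx (y := (t, φ)) hφ w)
    (fderiv_energy hx (y := (t, φ)) hφ w) (fderiv_solPos_time hx (y := (t, φ)) hφ)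
    (fderiv_fderiv_solPos_symm hx (y := (t, φ)) hφ (1, 0) w)

theorem solPos_zero (hx : ∀ i : Fin n, α i ≠ 0 → x₀ i.castSucc ≠ 0) {φ : Fin n → ℝ}
    (hφ : φ ∈ regularSet α) : solPos α x₀ (0, φ) = x₀ :=
  congrArg Prod.fst (isExtremalFrom_sol hx hφ).2

theorem hasDerivAt_solPos_param (hx : ∀ i : Fin n, α i ≠ 0 → x₀ i.castSucc ≠ 0)
    {φ : Fin n → ℝ} (hφ : φ ∈ regularSet α) (e : Fin n → ℝ) (t : ℝ) :
    HasDerivAt (fun r : ℝ => solPos α x₀ (t, φ + r • e))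
      (fderiv ℝ (solPos α x₀) (t, φ) (0, e)) 0 := by
  simpa using (differentiableAt_solPos hx (y := (t, φ)) hφ).hasDerivAt_comp_line (0, e)

theorem fderiv_solPos_zero (hx : ∀ i : Fin n, α i ≠ 0 → x₀ i.castSucc ≠ 0)
    {φ : Fin n → ℝ} (hφ : φ ∈ regularSet α) (e : Fin n → ℝ) :
    fderiv ℝ (solPos α x₀) (0, φ) (0, e) = 0 := by
  refine (hasDerivAt_solPos_param hx hφ e 0).unique
    ((hasDerivAt_const (0 : ℝ) x₀).congr_of_eventuallyEq ?_)
  have := (hasDerivAt_line φ e).continuousAt.eventually (p := fun z => z ∈ regularSet α)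
    (by simpa using (isOpen_regularSet α).mem_nhds hφ)
  filter_upwards [this] with r hr
  exact solPos_zero hx hr

theorem solMom_dotProduct_param (hx : ∀ i : Fin n, α i ≠ 0 → x₀ i.castSucc ≠ 0)
    {φ : Fin n → ℝ} (hφ : φ ∈ regularSet α) (e : Fin n → ℝ) (t : ℝ) :
    solMom α x₀ (t, φ) ⬝ᵥ fderiv ℝ (solPos α x₀) (t, φ) (0, e) = 0 := by
  have h := hasDerivAt_solMom_dotProduct hx hφ (0, e)
  have := is_const_of_deriv_eq_zero (fun s => (h s).differentiableAt) (fun s => (h s).deriv) t 0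
  rw [this, fderiv_solPos_zero hx hφ, dotProduct_zero]

/-! ### Triangular structure and diagonal entries of the Jacobian matrix -/

theorem delta_congr {φ ψ : Fin n → ℝ} {i : Fin n} (h : φ i = ψ i) :
    delta α x₀ φ i = delta α x₀ ψ i := by
  rw [delta, delta, h]

theorem prefixProd_delta_congr {φ ψ : Fin n → ℝ} {j : Fin (n + 1)}
    (h : ∀ i : Fin n, i.castSucc < j → φ i = ψ i) :
    prefixProd (delta α x₀ φ) j = prefixProd (delta α x₀ ψ) j :=
  prefixProd_congr fun i hi => delta_congr (h i hi)

theorem omega_congr {φ ψ : Fin n → ℝ} {i : Fin n} (h : ∀ k ≤ i, φ k = ψ k) :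
    omega α x₀ φ i = omega α x₀ ψ i := by
  rw [omega_eq, omega_eq, h i le_rfl,
    prefixProd_delta_congr fun k hk => h k (Fin.castSucc_lt_castSucc_iff.1 hk).le]

theorem profile_congr {φ ψ : Fin n → ℝ} {i : Fin n} (h : ∀ k ≤ i, φ k = ψ k) (τ : ℝ) :
    profile α x₀ i φ τ = profile α x₀ i ψ τ := by
  rw [profile, profile, h i le_rfl, omega_congr h,
    prefixProd_delta_congr fun k hk => h k (Fin.castSucc_lt_castSucc_iff.1 hk).le]

/-- The recursion for `ξ_j²` meets only the angles before `j`; this is the source of the triangular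
shape. -/
theorem speed_congr {φ ψ : Fin n → ℝ} {j : Fin (n + 1)}
    (h : ∀ i : Fin n, i.castSucc < j → φ i = ψ i) (t : ℝ) :
    speed α x₀ j (t, φ) = speed α x₀ j (t, ψ) := by
  induction j using Fin.induction generalizing t with
  | zero => rfl
  | succ i ih =>
    have hi := ih fun k hk => h k (hk.trans Fin.castSucc_lt_succ)
    have hc : clock α x₀ i.castSucc (t, φ) = clock α x₀ i.castSucc (t, ψ) := by
      simp only [clock, hi]
    rw [speed_succ, speed_succ, hi, hc,
      profile_congr fun k hk => h k (Fin.castSucc_lt_succ_iff.2 hk)]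

theorem clock_congr {φ ψ : Fin n → ℝ} {j : Fin (n + 1)}
    (h : ∀ i : Fin n, i.castSucc < j → φ i = ψ i) (t : ℝ) :
    clock α x₀ j (t, φ) = clock α x₀ j (t, ψ) := by
  simp only [clock, speed_congr h]

theorem fderiv_solPos_of_lt (hx : ∀ i : Fin n, α i ≠ 0 → x₀ i.castSucc ≠ 0)
    {φ : Fin n → ℝ} (hφ : φ ∈ regularSet α) (t : ℝ) {i l : Fin n} (hil : i < l) :
    fderiv ℝ (solPos α x₀) (t, φ) (0, Pi.single l 1) i.castSucc = 0 := by
  refine (hasDerivAt_pi.1 (hasDerivAt_solPos_param hx hφ (Pi.single l 1) t) i.castSucc).unique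
    ((hasDerivAt_const (0 : ℝ) (solPos α x₀ (t, φ) i.castSucc)).congr_of_eventuallyEq
      (Eventually.of_forall fun r => ?_))
  have h : ∀ k ≤ i, (φ + r • (Pi.single l 1 : Fin n → ℝ)) k = φ k := fun k hk => by
    simp [Pi.single_eq_of_ne (hk.trans_lt hil).ne]
  simp only [solPos_castSucc]
  rw [clock_congr fun k hk => h k (Fin.castSucc_lt_castSucc_iff.1 hk).le, profile_congr h]

/-- `S_j` as a function of the time `τ = ∫ ξ_j²`. -/
noncomputable def factorS (α : Fin n → ℕ) (x₀ : Fin (n + 1) → ℝ) (φ : Fin n → ℝ) (i : Fin n)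
    (τ : ℝ) : ℝ :=
  if α i = 0 then τ
  else genCos (α i) (omega α x₀ φ i * τ + φ i)
        * (genCot (α i) (φ i) * (omega α x₀ φ i * τ) + 1)
      - genCot (α i) (φ i) * genSin (α i) (omega α x₀ φ i * τ + φ i)

/-- The clock of `x_i` and `P_i` involve earlier angles only, so `τ` is frozen. For `α_i ≠ 0`, `φ_i`
acts through the amplitude, the frequency and the phase shift, and the amplitude factors out; for
`α_i = 0` it acts through the slope `cos φ_i`. -/
theorem fderiv_solPos_diag (hx : ∀ i : Fin n, α i ≠ 0 → x₀ i.castSucc ≠ 0)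
    {φ : Fin n → ℝ} (hφ : φ ∈ regularSet α) (t : ℝ) (i : Fin n) :
    fderiv ℝ (solPos α x₀) (t, φ) (0, Pi.single i 1) i.castSucc
      = (if α i = 0 then -(delta α x₀ φ i * prefixProd (delta α x₀ φ) i.castSucc)
          else x₀ i.castSucc / genSin (α i) (φ i))
        * factorS α x₀ φ i (clock α x₀ i.castSucc (t, φ)) := by
  refine (hasDerivAt_pi.1 (hasDerivAt_solPos_param hx hφ (Pi.single i 1) t) i.castSucc).unique ?_
  set ψ : ℝ → Fin n → ℝ := fun r => φ + r • (Pi.single i 1 : Fin n → ℝ) with hψ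
  have hi : ∀ r, ψ r i = φ i + r := fun r => by simp [hψ]
  have hk : ∀ r, ∀ k : Fin n, k.castSucc < i.castSucc → ψ r k = φ k := fun r k hk => by
    simp [hψ, Pi.single_eq_of_ne (Fin.castSucc_lt_castSucc_iff.1 hk).ne]
  have hp : ∀ r, prefixProd (delta α x₀ (ψ r)) i.castSucc
      = prefixProd (delta α x₀ φ) i.castSucc := fun r => prefixProd_delta_congr (hk r)
  have hc : ∀ r, clock α x₀ i.castSucc (t, ψ r) = clock α x₀ i.castSucc (t, φ) :=
    fun r => clock_congr (hk r) t
  change HasDerivAt (fun r => solPos α x₀ (t, ψ r) i.castSucc) _ 0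
  simp only [solPos_castSucc, hc]
  generalize clock α x₀ i.castSucc (t, φ) = τ
  have hadd : HasDerivAt (fun r : ℝ => φ i + r) 1 0 := (hasDerivAt_id (0 : ℝ)).const_add (φ i)
  by_cases h0 : α i = 0
  · simp only [profile, factorS, if_pos h0, hp, hi]
    have h1 : HasDerivAt (fun r : ℝ => Real.cos (φ i + r)) (-Real.sin (φ i) * 1) 0 :=
      HasDerivAt.comp_of_eq (0 : ℝ) (Real.hasDerivAt_cos (φ i)) hadd (by simp)
    refine (((h1.mul_const _).mul_const τ).const_add _).congr_deriv ?_
    rw [delta, if_pos h0]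
    ring
  · simp only [profile, factorS, if_neg h0, omega_eq, hp, hi]
    have h1 := genSin_ne_zero_of_regular hφ h0
    have h2 := hx i h0
    have hs : HasDerivAt (fun r : ℝ => genSin (α i) (φ i + r)) (genCos (α i) (φ i)) 0 := by
      simpa [Function.comp_def] using HasDerivAt.comp_of_eq (0 : ℝ) (hasDerivAt_genSin h0 (φ i)) hadd (by simp)
    set P := prefixProd (delta α x₀ φ) i.castSucc
    have hin : HasDerivAt (fun r : ℝ => genSin (α i) (φ i + r) / x₀ i.castSucc * P * τ + (φ i + r))
        (genCos (α i) (φ i) / x₀ i.castSucc * P * τ + 1) 0 :=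
      (((hs.div_const _).mul_const _).mul_const _).add hadd
    have hout := HasDerivAt.comp_of_eq (0 : ℝ)
      (hasDerivAt_genSin h0 (genSin (α i) (φ i) / x₀ i.castSucc * P * τ + φ i)) hin (by simp)
    have hA := (hs.fun_inv (by simpa using h1)).const_mul (x₀ i.castSucc)
    refine (hA.mul hout).congr_deriv ?_ |>.congr_of_eventuallyEq
      (Eventually.of_forall fun r => ?_)
    · simp only [add_zero, Function.comp_apply, genCot]
      field_simp
      ring
    · simp [div_eq_mul_inv]

/-! ### The determinant and the prefactor `g` -/

/-- A Hessenberg determinant whose rows satisfy `∑ p_k M_k = e₀`. -/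
theorem det_of_vecMul_eq_single (M : Matrix (Fin (n + 1)) (Fin (n + 1)) ℝ)
    (p : Fin (n + 1) → ℝ) (hp0 : p ⬝ᵥ (fun k => M k 0) = 1)
    (hps : ∀ l : Fin n, p ⬝ᵥ (fun k => M k l.succ) = 0)
    (hM : ∀ i l : Fin n, i < l → M i.castSucc l.succ = 0) :
    p (Fin.last n) * M.det = (-1) ^ n * ∏ i : Fin n, M i.castSucc i.succ := by
  -- Replacing the last row by the combination of all rows multiplies the determinant by the last
  -- coefficient; the new row has a single entry `1` in the first column.
  rw [← smul_eq_mul, ← Matrix.det_updateRow_sum M (Fin.last n) p,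
    Matrix.det_succ_row _ (Fin.last n), Fin.sum_univ_succ]
  have hrow : ∀ l, (∑ k, p k • M k) l = p ⬝ᵥ fun k => M k l := fun l => by
    simp [dotProduct]
  simp only [Matrix.updateRow_self, hrow, hp0, hps, mul_zero, zero_mul, Finset.sum_const_zero,
    add_zero, mul_one, Fin.val_last, Fin.val_zero]
  congr 1
  -- Without the first column and last row, the superdiagonal becomes the diagonal and the minor is
  -- lower triangular.
  rw [Matrix.det_of_isLowerTriangular]
  · refine Finset.prod_congr rfl fun i _ => ?_
    simp
  · intro i l hil
    simp only [Matrix.submatrix_apply, Fin.succAbove_last, Fin.succAbove_zero,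
      Matrix.updateRow_ne (Fin.castSucc_ne_last i)]
    exact hM i l hil

theorem rho_mul_abs_inv_pow {a : ℕ} (ha : a ≠ 0) {x : ℝ} (hx : x ≠ 0) :
    rho a x⁻¹ * |x| ^ (a + 1) = x := by
  obtain ⟨b, rfl⟩ := Nat.exists_eq_succ_of_ne_zero ha
  have h : |x| ≠ 0 := abs_ne_zero.2 hx
  rw [rho, abs_inv, Nat.succ_eq_add_one, Nat.add_sub_cancel, pow_add |x| (b + 1) 1,
    pow_succ |x| b, inv_pow]
  field_simp
  rw [sq_abs]

/-- Holds index by index. For `j ∈ J`, `rho_mul_abs_inv_pow` turns `δ_j` times the power in `g` into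
`x⁰_j / sin φ_j`, with sign from `(-1)^|J|`; for `j ∉ J` the sign is the one from differentiating
the cosine. -/
theorem prod_delta_mul_gfun (hx : ∀ i : Fin n, α i ≠ 0 → x₀ i.castSucc ≠ 0)
    {φ : Fin n → ℝ} (hφ : φ ∈ regularSet α) :
    (∏ i, delta α x₀ φ i) * gfun α x₀ φ = (-1) ^ n * ∏ i : Fin n,
      (if α i = 0 then -(delta α x₀ φ i * prefixProd (delta α x₀ φ) i.castSucc)
        else x₀ i.castSucc / genSin (α i) (φ i)) := by
  have hn : (-1 : ℝ) ^ n = ∏ _i : Fin n, (-1 : ℝ) := by simp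
  rw [gfun, ← Finset.prod_const, Finset.prod_filter, Finset.prod_filter, Finset.prod_filter, hn,
    ← Finset.prod_mul_distrib, ← Finset.prod_mul_distrib, ← Finset.prod_mul_distrib,
    ← Finset.prod_mul_distrib]
  refine Finset.prod_congr rfl fun i _ => ?_
  by_cases h0 : α i = 0
  · simp only [h0, ne_eq, not_true_eq_false, if_true, if_false, prefixProd_castSucc]
    ring
  · have h1 := genSin_ne_zero_of_regular hφ h0
    simp only [h0, ne_eq, not_false_eq_true, if_true, if_false]
    have h2 := rho_mul_abs_inv_pow h0 (div_ne_zero (hx i h0) h1)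
    rw [inv_div] at h2
    rw [delta, if_neg h0]
    linear_combination -h2

theorem gfun_ne_zero (hx : ∀ i : Fin n, α i ≠ 0 → x₀ i.castSucc ≠ 0)
    {φ : Fin n → ℝ} (hφ : φ ∈ regularSet α) : gfun α x₀ φ ≠ 0 := by
  refine mul_ne_zero (mul_ne_zero (pow_ne_zero _ (by norm_num)) ?_) ?_
  · exact Finset.prod_ne_zero_iff.2 fun j _ =>
      Finset.prod_ne_zero_iff.2 fun i _ => delta_ne_zero hx hφ i
  · refine Finset.prod_ne_zero_iff.2 fun j hj => pow_ne_zero _ (abs_ne_zero.2 ?_)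
    have hj' := (Finset.mem_filter.1 hj).2
    exact div_ne_zero (hx j hj') (genSin_ne_zero_of_regular hφ hj')

theorem xiInt_eq_clock (hx : ∀ i : Fin n, α i ≠ 0 → x₀ i.castSucc ≠ 0)
    {φ : Fin n → ℝ} (hφ : φ ∈ regularSet α) (j : Fin n) (t : ℝ) :
    xiInt α x₀ φ j t = clock α x₀ j.castSucc (t, φ) := by
  simp only [xiInt, clock, geodesic_eq (isExtremalFrom_sol hx hφ), speed_eq_xi_sq]

theorem Sfun_eq_factorS (hx : ∀ i : Fin n, α i ≠ 0 → x₀ i.castSucc ≠ 0)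
    {φ : Fin n → ℝ} (hφ : φ ∈ regularSet α) (j : Fin n) (t : ℝ) :
    Sfun α x₀ φ j t = factorS α x₀ φ j (clock α x₀ j.castSucc (t, φ)) := by
  simp only [Sfun, Qfun, factorS, xiInt_eq_clock hx hφ]

/-- The continuous linear map `(t, φ_1, …, φ_n) ↦ (t, φ)`. -/
noncomputable def splitCoord (n : ℕ) : (Fin (n + 1) → ℝ) →L[ℝ] ℝ × (Fin n → ℝ) :=
  (ContinuousLinearMap.proj 0).prod (ContinuousLinearMap.pi fun i => ContinuousLinearMap.proj i.succ)

theorem splitCoord_apply (y : Fin (n + 1) → ℝ) : splitCoord n y = (y 0, Fin.tail y) := rfl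

/-- By homogeneity the exponential map agrees with the explicit solution at every regular angle, and
regularity is an open condition, so the two share their derivative. -/
theorem hasFDerivAt_expCoord (hx : ∀ i : Fin n, α i ≠ 0 → x₀ i.castSucc ≠ 0)
    {φ : Fin n → ℝ} (hφ : φ ∈ regularSet α) (t : ℝ) :
    HasFDerivAt (expCoord α x₀) ((fderiv ℝ (solPos α x₀) (t, φ)).comp (splitCoord n))
      (Fin.cons t φ) := by
  have hT : splitCoord n (Fin.cons t φ) = (t, φ) := by
    rw [splitCoord_apply, Fin.cons_zero, Fin.tail_cons]
  have h : HasFDerivAt (fun y => solPos α x₀ (splitCoord n y))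
      ((fderiv ℝ (solPos α x₀) (t, φ)).comp (splitCoord n)) (Fin.cons t φ) := by
    have h1 : HasFDerivAt (solPos α x₀) (fderiv ℝ (solPos α x₀) (t, φ))
        (splitCoord n (Fin.cons t φ)) := by
      rw [hT]
      exact (differentiableAt_solPos hx (y := (t, φ)) hφ).hasFDerivAt
    exact h1.comp (Fin.cons t φ : Fin (n + 1) → ℝ) (splitCoord n).hasFDerivAt
  refine h.congr_of_eventuallyEq ?_
  have hev : ∀ᶠ y in 𝓝 (Fin.cons t φ : Fin (n + 1) → ℝ), (splitCoord n y).2 ∈ regularSet α :=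
    (splitCoord n).continuous.continuousAt.eventually (by
      rw [hT]; exact eventually_regular (y := (t, φ)) hφ)
  filter_upwards [hev] with y hy
  exact expMap_smul (isExtremalFrom_sol hx hy) (y 0)

theorem jacobianDet_eq (hx : ∀ i : Fin n, α i ≠ 0 → x₀ i.castSucc ≠ 0)
    {φ : Fin n → ℝ} (hφ : φ ∈ regularSet α) (t : ℝ) :
    jacobianDet α x₀ t φ = gfun α x₀ φ * ∏ j, Sfun α x₀ φ j t := by
  have h0 : splitCoord n (Pi.single 0 1) = (1, 0) := by
    refine Prod.ext (by simp [splitCoord_apply]) (funext fun i => ?_)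
    simp [splitCoord_apply, Fin.tail]
  have hs : ∀ l : Fin n, splitCoord n (Pi.single l.succ 1) = (0, Pi.single l 1) := fun l => by
    refine Prod.ext (by simp [splitCoord_apply])
      (funext fun i => ?_)
    simp [splitCoord_apply, Fin.tail, Pi.single_apply]
  have hfd := (hasFDerivAt_expCoord hx hφ t).fderiv
  have key := det_of_vecMul_eq_single
    (Matrix.of fun k l : Fin (n + 1) =>
      fderiv ℝ (expCoord α x₀) (Fin.cons t φ) (Pi.single l 1) k) (solMom α x₀ (t, φ))
    (by
      simp only [Matrix.of_apply, hfd, ContinuousLinearMap.comp_apply, h0]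
      exact solMom_dotProduct_velocity hx hφ)
    (fun l => by
      simp only [Matrix.of_apply, hfd, ContinuousLinearMap.comp_apply, hs]
      exact solMom_dotProduct_param hx hφ _ t)
    (fun i l hil => by
      simp only [Matrix.of_apply, hfd, ContinuousLinearMap.comp_apply, hs]
      exact fderiv_solPos_of_lt hx hφ t hil)
  simp only [Matrix.of_apply, hfd, ContinuousLinearMap.comp_apply, hs,
    fderiv_solPos_diag hx hφ, Finset.prod_mul_distrib, ← Sfun_eq_factorS hx hφ] at key
  -- This product is `p_{n+1}`, the coefficient of the last row, to be cancelled at the end.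
  have hδ : (∏ i, delta α x₀ φ i) ≠ 0 :=
    Finset.prod_ne_zero_iff.2 fun i _ => delta_ne_zero hx hφ i
  rw [← mul_assoc, ← prod_delta_mul_gfun hx hφ, solMom_last, prefixProd_last, mul_assoc] at key
  simp only [jacobianDet, hfd, ContinuousLinearMap.comp_apply]
  exact mul_left_cancel₀ hδ key

end Grushin

theorem mainTheorem8 (n : ℕ) (hn : 1 ≤ n) (α : Fin n → ℕ) (x₀ : Fin (n + 1) → ℝ)
    (hx₀ : Grushin.IsRiemannianPoint α x₀) (φ : Fin n → ℝ) (hφ : φ ∈ Grushin.coordRect₀ α) :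
    (∃! z, Grushin.IsExtremalFrom α x₀ (Grushin.covector α x₀ φ) z) ∧
    Grushin.gfun α x₀ φ ≠ 0 ∧
    ∀ t : ℝ,
      DifferentiableAt ℝ (Grushin.expCoord α x₀) (Fin.cons t φ) ∧
      Grushin.jacobianDet α x₀ t φ = Grushin.gfun α x₀ φ * ∏ j, Grushin.Sfun α x₀ φ j t := by
  have hx : ∀ i : Fin n, α i ≠ 0 → x₀ i.castSucc ≠ 0 := fun _ hi => hx₀.ne_zero hi
  have hr : φ ∈ Grushin.regularSet α := hφ.2
  have hsol := Grushin.isExtremalFrom_sol hx hr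
  exact ⟨⟨_, hsol, fun _ hw => Grushin.IsExtremalFrom.eq hw hsol⟩, Grushin.gfun_ne_zero hx hr,
    fun t => ⟨(Grushin.hasFDerivAt_expCoord hx hr t).differentiableAt,
      Grushin.jacobianDet_eq hx hr t⟩⟩
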